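/- Let $T\in(0,\infty)$, $\tau\in(0,T)$, $\tau_1\in(\tau,T)$, $\tau_2\in(\tau_1,T)$, and let $f,g\in C^\infty(\mathbb{R},\mathbb{R})$ satisfy $\sup_{x\in\mathbb{R}}(|f(x)|+|g(x)|)<\infty$, $f((-\infty,\tau_1))\subseteq(0,\infty)$, $f([\tau_1,\infty))=\{0\}$, $f'(\mathbb{R})\subseteq[-2,0]$, $f'((0,\tau))\subseteq[-2,-1)$, $g((-\infty,\tau_1])=\{0\}$, $g([\tau_2,\infty))=\{4\}$, $g'(\mathbb{R})\subseteq[0,\infty)$, and $\alpha:=\int_0^{\tau_1}|f(s)|^2\,ds\ge\frac{2\tau^3}{3}$. Let $(\Omega,\mathcal{F},\mathbb{P})$ be a probability space with a normal filtration $\mathbb{F}=(\mathbb{F}_t)_{t\in[0,T]}$ (that is, $\mathbb{F}$ is right-continuous and $\mathbb{F}_0$ contains every $A\in\mathcal{F}$ with $\mathbb{P}(A)=0$), and let $W\colon[0,T]\times\Omega\to\mathbb{R}$ be a standard $\mathbb{F}$-Brownian motion with continuous sample paths. For every $\psi\in C^\infty(\mathbb{R},\mathbb{R})$ let $X^{\psi,(1)},X^{\psi,(2)}\colon[0,T]\times\Omega\to\mathbb{R}$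 be continuous $\mathbb{F}$-adapted stochastic processes which satisfy for all $t\in[0,T]$, $\mathbb{P}$-almost surely, $$X^{\psi,(1)}_t=\int_0^t f(X^{\psi,(2)}_s)\,dW_s,\qquad X^{\psi,(2)}_t=t+\int_0^t g(X^{\psi,(2)}_s)\,\bigl[\cos(\psi(X^{\psi,(1)}_s))+1\bigr]\,ds,$$ where $dW$ denotes the Itô integral. Let $(\varepsilon_n)_{n\in\mathbb{N}}\subseteq(0,\tau]$ and $(\delta_n)_{n\in\mathbb{N}}\subseteq\mathbb{R}$ be sequences with $\limsup_{n\to\infty}\delta_n\le0$. Then there exist a function $\psi\in C^\infty(\mathbb{R},\mathbb{R})$, a real number $c\in(0,\infty)$, a Borel measurable function $\Phi\colon C([0,T],\mathbb{R})\to\mathbb{R}$, and a continuous $\mathbb{F}$-adapted stochastic process $Z\colon[0,T]\times\Omega\to\mathbb{R}$ such that for all $n\in\mathbb{N}$, $t\in[0,T]$ it holds that $$\mathbb{P}\bigl(Z_T=\Phi((W_s)_{s\in[0,T]})\bigr)=1,\qquad \mathbb{P}\Bigl(X^{\psi,(1)}_t=\int_0^t f\bigl(\tfrac{Z_s}{c}\bigr)\,dW_s\Bigr)=1,$$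 $$\mathbb{P}\Bigl(Z_t=\int_0^t c+c\,g\bigl(\tfrac{Z_s}{c}\bigr)\bigl[\cos(\psi(X^{\psi,(1)}_s))+1\bigr]\,ds\Bigr)=1,$$ and $$\inf_{\substack{a,b\in[0,\tau],\\ b-a\ge\varepsilon_n}}\ \inf_{\substack{u\colon C([0,a]\cup[b,T],\mathbb{R})\to\mathbb{R}\\ \text{Borel measurable}}}\mathbb{E}\Bigl[\bigl|Z_T-u\bigl((W_s)_{s\in[0,a]\cup[b,T]}\bigr)\bigr|\Bigr]\ge\delta_n .$$ -/

import Mathlib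

open MeasureTheory ProbabilityTheory Filter Set
open scoped ENNReal NNReal Topology

noncomputable section

namespace SlowSDE

variable {Ω : Type*} {m : MeasurableSpace Ω} {T : ℝ}

/-- Lebesgue measure on the time interval `[0, T]`. -/
def timeMeasure (T : ℝ) : Measure (Icc (0 : ℝ) T) :=
  Measure.comap Subtype.val volume

/-- A normal filtration on `[0, T]`: it is right-continuous and its initial σ-algebra (equivalently,
by monotonicity, each of its σ-algebras) contains every event of probability zero. -/
structure IsNormalFiltration (𝓕 : Filtration (Icc (0 : ℝ) T) m) (P : Measure Ω) : Prop where
  rightContinuous : 𝓕.IsRightContinuous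
  null_mem : ∀ A : Set Ω, MeasurableSet[m] A → P A = 0 → ∀ t, MeasurableSet[𝓕 t] A

/-- A stochastic process on `[0, T]` which is adapted and all of whose sample paths are
continuous. -/
structure IsContinuousAdapted (𝓕 : Filtration (Icc (0 : ℝ) T) m)
    (X : Icc (0 : ℝ) T → Ω → ℝ) : Prop where
  adapted : Adapted 𝓕 X
  continuous_path : ∀ ω, Continuous fun t ↦ X t ω

/-- A one-dimensional standard Brownian motion on `[0, T]` with respect to the filtration `𝓕`:
a continuous `𝓕`-adapted process which starts almost surely in zero and whose increment from `s` to
`t` has the law `N(0, t - s)` and is independent of `𝓕 s`. -/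
structure IsStandardBrownianMotion (𝓕 : Filtration (Icc (0 : ℝ) T) m) (P : Measure Ω)
    (W : Icc (0 : ℝ) T → Ω → ℝ) : Prop extends IsContinuousAdapted 𝓕 W where
  start_zero : ∀ t : Icc (0 : ℝ) T, (t : ℝ) = 0 → ∀ᵐ ω ∂P, W t ω = 0
  law_increment : ∀ s t : Icc (0 : ℝ) T, s ≤ t →
    HasLaw (fun ω ↦ W t ω - W s ω) (gaussianReal 0 (Real.toNNReal ((t : ℝ) - s))) P
  indep_increment : ∀ s t : Icc (0 : ℝ) T, s ≤ t →
    Indep (MeasurableSpace.comap (fun ω ↦ W t ω - W s ω) (inferInstance : MeasurableSpace ℝ)) (𝓕 s) P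

/-- The data of a simple (elementary predictable) process
`H_t(ω) = ∑ i, ξ i ω * 1_{(left i, right i]}(t)` on `[0, T]`, where each `ξ i` is bounded and
measurable with respect to the σ-algebra at time `left i`. The intervals may overlap. -/
structure SimpleProcess (𝓕 : Filtration (Icc (0 : ℝ) T) m) where
  /-- the number of summands -/
  n : ℕ
  /-- the left end points -/
  left : Fin n → Icc (0 : ℝ) T
  /-- the right end points -/
  right : Fin n → Icc (0 : ℝ) T
  left_le_right : ∀ i, left i ≤ right i
  /-- the random coefficients -/
  ξ : Fin n → Ω → ℝ
  measurable_ξ : ∀ i, Measurable[𝓕 (left i)] (ξ i)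
  bounded_ξ : ∀ i, ∃ C : ℝ, ∀ ω, |ξ i ω| ≤ C

/-- The values of a simple process. -/
def SimpleProcess.eval {𝓕 : Filtration (Icc (0 : ℝ) T) m} (H : SimpleProcess 𝓕)
    (t : Icc (0 : ℝ) T) (ω : Ω) : ℝ :=
  ∑ i, (Ioc (H.left i) (H.right i)).indicator (fun _ ↦ H.ξ i ω) t

/-- The elementary stochastic integral `∫_0^t H_s dW_s` of a simple process. -/
def SimpleProcess.integral {𝓕 : Filtration (Icc (0 : ℝ) T) m} (H : SimpleProcess 𝓕)
    (W : Icc (0 : ℝ) T → Ω → ℝ) (t : Icc (0 : ℝ) T) (ω : Ω) : ℝ :=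
  ∑ i, H.ξ i ω * (W (min (H.right i) t) ω - W (min (H.left i) t) ω)

/-- `HasItoIntegral 𝓕 P W h t Y` means that the process `h` is Itô-integrable on `[0, t]` in the
mean-square sense and that `Y = ∫_0^t h_s dW_s` holds `P`-almost surely. This is the `L²`
construction of the Itô integral: `h` is progressively measurable, there are simple processes `H k`
with `𝔼 ∫_0^t |H k_s - h_s|² ds → 0`, and their elementary integrals converge to `Y` in `L²(P)`. -/
def HasItoIntegral (𝓕 : Filtration (Icc (0 : ℝ) T) m) (P : Measure Ω)
    (W h : Icc (0 : ℝ) T → Ω → ℝ) (t : Icc (0 : ℝ) T) (Y : Ω → ℝ) : Prop :=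
  IsProgressive 𝓕 h ∧ AEMeasurable Y P ∧
  ∃ H : ℕ → SimpleProcess 𝓕,
    Tendsto (fun k ↦ ∫⁻ ω, (∫⁻ s in Iic t, ‖(H k).eval s ω - h s ω‖ₑ ^ 2 ∂timeMeasure T) ∂P) atTop (𝓝 0) ∧
    Tendsto (fun k ↦ ∫⁻ ω, ‖(H k).integral W t ω - Y ω‖ₑ ^ 2 ∂P) atTop (𝓝 0)

/-- `(X₁, X₂)` is a continuous adapted solution on `[0, T]` of the two-dimensional SDE
`X₁_t = ∫_0^t f(X₂_s) dW_s`, `X₂_t = t + ∫_0^t g(X₂_s) (cos (ψ (X₁_s)) + 1) ds`. Here `Iic t` is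
the interval `[0, t]` as a subset of the index set `[0, T]`. -/
structure IsSolution (𝓕 : Filtration (Icc (0 : ℝ) T) m) (P : Measure Ω)
    (W : Icc (0 : ℝ) T → Ω → ℝ) (f g ψ : ℝ → ℝ) (X₁ X₂ : Icc (0 : ℝ) T → Ω → ℝ) : Prop where
  continuousAdapted₁ : IsContinuousAdapted 𝓕 X₁
  continuousAdapted₂ : IsContinuousAdapted 𝓕 X₂
  eq₁ : ∀ t, HasItoIntegral 𝓕 P W (fun s ω ↦ f (X₂ s ω)) t (X₁ t)
  eq₂ : ∀ t : Icc (0 : ℝ) T, ∀ᵐ ω ∂P,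
    X₂ t ω = (t : ℝ) + ∫ s in Iic t, g (X₂ s ω) * (Real.cos (ψ (X₁ s ω)) + 1) ∂timeMeasure T

/-- The sample path `(W_s(ω))_{s ∈ S}` as an element of `C(S, ℝ)`, for `S ⊆ [0, T]`. -/
def pathOn (W : Icc (0 : ℝ) T → Ω → ℝ) (hW : ∀ ω, Continuous fun t ↦ W t ω)
    (S : Set ℝ) (hS : S ⊆ Icc 0 T) (ω : Ω) : C(S, ℝ) where
  toFun s := W ⟨s, hS s.2⟩ ω
  continuous_toFun := (hW ω).comp (continuous_inclusion hS)

/-- The smallest `L¹`-error `inf_u 𝔼 |Y - u((W_s)_{s ∈ S})|` of an approximation of the random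
variable `Y` by a Borel measurable function `u : C(S, ℝ) → ℝ` of the path of `W` on `S`, where
`C(S, ℝ)` carries the topology of uniform convergence on compact sets. The expectation takes values
in `[0, ∞]`. -/
def approxError (P : Measure Ω) (W : Icc (0 : ℝ) T → Ω → ℝ)
    (hW : ∀ ω, Continuous fun t ↦ W t ω) (S : Set ℝ) (hS : S ⊆ Icc 0 T) (Y : Ω → ℝ) : ℝ≥0∞ :=
  ⨅ (u : C(S, ℝ) → ℝ) (_ : Measurable[borel C(S, ℝ)] u),
    ∫⁻ ω, ‖Y ω - u (pathOn W hW S hS ω)‖ₑ ∂P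

/-- The complement `[0, a] ∪ [b, T]` of a gap is contained in `[0, T]`. -/
theorem outsideGap_subset {a b τ T : ℝ} (hτ : τ < T) (ha : a ∈ Icc 0 τ) (hb : b ∈ Icc 0 τ) :
    Icc 0 a ∪ Icc b T ⊆ Icc 0 T :=
  union_subset (Icc_subset_Icc_right (ha.2.trans hτ.le)) (Icc_subset_Icc_left hb.1)

end SlowSDE

end

/-! While `X₂ ≤ τ₁` the coefficient `g` vanishes, so `X₂` is the identity on `[0, τ₁]`. Hence `X₁`
is the Wiener integral of the deterministic function `f`; it is frozen after `τ₁` at a value `L`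
with law `N(0, α)`. From `τ₁` on, `X₂` solves the autonomous equation `y' = 1 + q g(y)` with random
constant `q = cos (ψ L) + 1`. Separation of variables (`IsTerminalValue.sub_le`) shows that its
terminal value is a function `F q` whose increments are at least `κ` times those of `q`, so
oscillations of `cos ∘ ψ` survive in `X₂_T`.

If `W` is unknown on `(a, b)`, then `L = U + V`, where `U` is determined by the known part of the
path and `V` is independent of it and centred Gaussian: `V` is the integral of `f` minus its mean
over `[a, b]`, a functional of the Brownian bridge (`exists_decomposition`). The slope bounds on `f`
place the variance `v` of `V` between `(b - a)³ / 12` and `(b - a)³ / 3`. Since `V` is symmetric, no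
functional of the known part can tell `U + V` from `U - V`, so the error is at least half of the
mean distance between the two outcomes (`lintegral_symmetrization_le`).

Where `ψ` has slope `l`, `cos (ψ (U + V)) - cos (ψ (U - V)) = -2 sin (l U) sin (l V)`. Once `l` is
large compared with `1 / √v`, the mean of this over a fixed window for `U` is bounded below
independently of `v` (`lintegral_cos_sub_cos_ge`). The smooth `ψ` has slope `l k` on the window
`[2k, 2k + 1]`, which gives an error bound `c * D k` with `D k > 0`. Because `limsup δ ≤ 0`, the
slopes can be taken so large that each gap length `ε n` is handled by a window with `δ n ≤ c * D k`
(`exists_slopes`). The factor `c`, introduced by `Z = c X₂`, absorbs the finitely many indices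
assigned to the first window. -/

noncomputable section

namespace SlowSDE

/-! ### Brownian motion: independence, covariance and Gaussian sums of increments. -/

section BrownianMotion

variable {Ω : Type*} {m : MeasurableSpace Ω} {T : ℝ}

/-- Random variables adapted to an increasing sequence of σ-algebras, each independent of the past,
are mutually independent. -/
theorem iIndepFun_of_indep_past {P : Measure Ω} [IsProbabilityMeasure P] {f : ℕ → Ω → ℝ}
    (𝓖 : ℕ → MeasurableSpace Ω) (hmono : Monotone 𝓖)
    (hf : ∀ i, Measurable[𝓖 (i + 1)] (f i))
    (hind : ∀ i, Indep (MeasurableSpace.comap (f i) inferInstance) (𝓖 i) P) :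
    iIndepFun f P := by
  rw [iIndepFun_iff_measure_inter_preimage_eq_mul]
  intro S
  induction S using Finset.induction_on_max with
  | empty => intro sets _; simp
  | insert a s hlt ih =>
    intro sets hsets
    have hnot : a ∉ s := fun h ↦ lt_irrefl _ (hlt a h)
    have hpast : MeasurableSet[𝓖 a] (⋂ i ∈ s, f i ⁻¹' sets i) := by
      refine MeasurableSet.biInter s.countable_toSet fun i hi ↦ ?_
      exact hmono (hlt i hi) _ (hf i (hsets i (Finset.mem_insert_of_mem hi)))
    rw [Finset.set_biInter_insert, Finset.prod_insert hnot,
      ← ih fun i hi ↦ hsets i (Finset.mem_insert_of_mem hi)]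
    exact (Indep_iff _ _ _).1 (hind a) _ _ ⟨_, hsets a (Finset.mem_insert_self _ _), rfl⟩ hpast

namespace IsStandardBrownianMotion

variable {𝓕 : Filtration (Icc (0 : ℝ) T) m} {P : Measure Ω} {W : Icc (0 : ℝ) T → Ω → ℝ}

theorem measurable (hW : IsStandardBrownianMotion 𝓕 P W) (t : Icc (0 : ℝ) T) :
    Measurable (W t) :=
  (hW.adapted t).mono (𝓕.le t) le_rfl

theorem hasIndepIncrements [IsProbabilityMeasure P] (hW : IsStandardBrownianMotion 𝓕 P W) :
    HasIndepIncrements W P := by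
  rw [hasIndepIncrements_iff_nat]
  intro t ht
  refine iIndepFun_of_indep_past (fun i ↦ 𝓕 (t i)) (fun i j hij ↦ 𝓕.mono (ht hij)) (fun i ↦ ?_)
    fun i ↦ hW.indep_increment _ _ (ht i.le_succ)
  exact (hW.adapted _).sub ((hW.adapted (t i)).mono (𝓕.mono (ht i.le_succ)) le_rfl)

theorem hasLaw (hT : 0 ≤ T) (hW : IsStandardBrownianMotion 𝓕 P W) (t : Icc (0 : ℝ) T) :
    HasLaw (W t) (gaussianReal 0 (Real.toNNReal t)) P := by
  have h0 := hW.start_zero ⟨0, left_mem_Icc.2 hT⟩ rfl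
  have h := hW.law_increment ⟨0, left_mem_Icc.2 hT⟩ t t.2.1
  simp only [sub_zero] at h
  refine h.congr ?_
  filter_upwards [h0] with ω hω
  simp [hω]

theorem isGaussianProcess [IsProbabilityMeasure P] (hT : 0 ≤ T)
    (hW : IsStandardBrownianMotion 𝓕 P W) : IsGaussianProcess W P := by
  let _ : OrderBot (Icc (0 : ℝ) T) := { bot := ⟨0, left_mem_Icc.2 hT⟩, bot_le := fun t ↦ t.2.1 }
  refine HasIndepIncrements.isGaussianProcess (fun t ↦ (hW.hasLaw hT t).hasGaussianLaw)
    (hW.start_zero _ rfl) hW.hasIndepIncrements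

theorem memLp [IsProbabilityMeasure P] (hT : 0 ≤ T)
    (hW : IsStandardBrownianMotion 𝓕 P W) (t : Icc (0 : ℝ) T) (p : ℝ≥0∞) (hp : p ≠ ∞) :
    MemLp (W t) p P :=
  ((hW.isGaussianProcess hT).hasGaussianLaw_eval t).memLp hp

theorem integral_increment (hW : IsStandardBrownianMotion 𝓕 P W) {s t : Icc (0 : ℝ) T}
    (hst : s ≤ t) : ∫ ω, (W t ω - W s ω) ∂P = 0 := by
  rw [(hW.law_increment s t hst).integral_eq, integral_id_gaussianReal]

theorem integral_increment_sq [IsProbabilityMeasure P] (hW : IsStandardBrownianMotion 𝓕 P W)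
    {s t : Icc (0 : ℝ) T} (hst : s ≤ t) : ∫ ω, (W t ω - W s ω) ^ 2 ∂P = t - s := by
  have h := (hW.law_increment s t hst).variance_eq
  rw [variance_id_gaussianReal, variance_of_integral_eq_zero
    (hW.law_increment s t hst).aemeasurable (hW.integral_increment hst)] at h
  rw [h, Real.coe_toNNReal _ (sub_nonneg.2 hst)]

theorem covariance_eq_of_le [IsProbabilityMeasure P] (hT : 0 ≤ T)
    (hW : IsStandardBrownianMotion 𝓕 P W) {s t : Icc (0 : ℝ) T} (hst : s ≤ t) :
    cov[W s, W t; P] = s := by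
  let _ : OrderBot (Icc (0 : ℝ) T) := { bot := ⟨0, left_mem_Icc.2 hT⟩, bot_le := fun t ↦ t.2.1 }
  have hind := hW.hasIndepIncrements.indepFun_eval_sub (bot_le (a := s)) hst (hW.start_zero _ rfl)
  have h2 : ∀ t, MemLp (W t) 2 P := fun t ↦ hW.memLp hT t 2 (by simp)
  have h0 := hind.covariance_eq_zero (h2 s) ((h2 t).sub (h2 s))
  have hsplit : W t = (W t - W s) + W s := by simp
  rw [hsplit, covariance_add_right (h2 s) ((h2 t).sub (h2 s)) (h2 s), h0, zero_add,
    covariance_self (hW.measurable s).aemeasurable, (hW.hasLaw hT s).variance_eq,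
    variance_id_gaussianReal, Real.coe_toNNReal _ s.2.1]

theorem covariance_eq [IsProbabilityMeasure P] (hT : 0 ≤ T)
    (hW : IsStandardBrownianMotion 𝓕 P W) (s t : Icc (0 : ℝ) T) :
    cov[W s, W t; P] = min (s : ℝ) t := by
  rcases le_total s t with h | h
  · rw [hW.covariance_eq_of_le hT h, min_eq_left (by exact_mod_cast h)]
  · rw [covariance_comm, hW.covariance_eq_of_le hT h, min_eq_right (by exact_mod_cast h)]

/-- Weighted sums of successive increments of a Brownian motion are centred Gaussian. -/
theorem hasLaw_sum_increments [IsProbabilityMeasure P] (hW : IsStandardBrownianMotion 𝓕 P W)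
    {t : ℕ → Icc (0 : ℝ) T} (ht : Monotone t) (c : ℕ → ℝ) (n : ℕ) :
    HasLaw (fun ω ↦ ∑ i ∈ Finset.range n, c i * (W (t (i + 1)) ω - W (t i) ω))
      (gaussianReal 0 (Real.toNNReal
        (∑ i ∈ Finset.range n, c i ^ 2 * ((t (i + 1) : ℝ) - t i)))) P := by
  have hind := (hW.hasIndepIncrements.nat ht).comp (fun i x ↦ c i * x) fun i ↦ by fun_prop
  have hmeas : ∀ i, Measurable ((fun x ↦ c i * x) ∘ fun ω ↦ W (t (i + 1)) ω - W (t i) ω) :=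
    fun i ↦ (measurable_const_mul _).comp ((hW.measurable _).sub (hW.measurable _))
  have hnn : ∀ i, 0 ≤ c i ^ 2 * ((t (i + 1) : ℝ) - t i) := fun i ↦
    mul_nonneg (sq_nonneg _) (sub_nonneg.2 (ht i.le_succ))
  induction n with
  | zero =>
    refine ⟨by simp, ?_⟩
    simp
  | succ n ih =>
    have h1 : HasLaw (fun ω ↦ c n * (W (t (n + 1)) ω - W (t n) ω))
        (gaussianReal 0 (Real.toNNReal (c n ^ 2 * ((t (n + 1) : ℝ) - t n)))) P := by
      convert gaussianReal_const_mul (hW.law_increment _ _ (ht n.le_succ)) (c n) using 2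
      · simp
      · rw [Real.toNNReal_mul (sq_nonneg _)]
        congr 1
        exact Real.toNNReal_of_nonneg _
    have h2 := hind.indepFun_sum_range_succ hmeas n
    have h3 : (fun ω ↦ ∑ i ∈ Finset.range n, c i * (W (t (i + 1)) ω - W (t i) ω)) ⟂ᵢ[P]
        (fun ω ↦ c n * (W (t (n + 1)) ω - W (t n) ω)) := by
      convert h2 using 1
      · ext ω
        simp
      · rfl
    have h4 := gaussianReal_add_gaussianReal_of_indepFun h3 ih.map_eq h1.map_eq
    refine ⟨ih.aemeasurable.add h1.aemeasurable |>.congr (.of_forall fun ω ↦ ?_), ?_⟩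
    · simp [Finset.sum_range_succ]
    · rw [Finset.sum_range_succ, Real.toNNReal_add (Finset.sum_nonneg fun i _ ↦ hnn i) (hnn n)]
      rw [add_zero] at h4
      rw [← h4]
      congr 1
      ext ω
      simp [Finset.sum_range_succ]

end IsStandardBrownianMotion

end BrownianMotion

/-! ### The Itô isometry for simple processes and identification of Itô integrals. -/

section ItoIsometry

variable {Ω : Type*} {m : MeasurableSpace Ω} {T : ℝ}

theorem enorm_sq_eq_ofReal (x : ℝ) : ‖x‖ₑ ^ 2 = ENNReal.ofReal (x ^ 2) := by
  rw [Real.enorm_eq_ofReal_abs, ← ENNReal.ofReal_pow (abs_nonneg x), sq_abs]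

theorem enorm_sub_sq_le (x y z : ℝ) :
    ‖x - z‖ₑ ^ 2 ≤ 2 * ‖x - y‖ₑ ^ 2 + 2 * ‖y - z‖ₑ ^ 2 := by
  simp only [enorm_sq_eq_ofReal]
  rw [← ENNReal.ofReal_ofNat 2, ← ENNReal.ofReal_mul (by norm_num),
    ← ENNReal.ofReal_mul (by norm_num), ← ENNReal.ofReal_add (by positivity) (by positivity)]
  exact ENNReal.ofReal_le_ofReal (by nlinarith [sq_nonneg (x - 2 * y + z)])

section TimeMeasure

theorem timeMeasure_apply (S : Set (Icc (0 : ℝ) T)) :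
    timeMeasure T S = volume (Subtype.val '' S) :=
  (MeasurableEmbedding.subtype_coe measurableSet_Icc).comap_apply _ _

instance isFiniteMeasure_timeMeasure : IsFiniteMeasure (timeMeasure T) := by
  refine ⟨?_⟩
  rw [timeMeasure_apply]
  exact (measure_mono (Subtype.coe_image_subset _ _)).trans_lt (by simp)

theorem timeMeasure_Ioc (a b : Icc (0 : ℝ) T) :
    timeMeasure T (Ioc a b) = ENNReal.ofReal (b - a) := by
  rw [timeMeasure_apply]
  have : Subtype.val '' Ioc a b = Ioc (a : ℝ) b := by
    ext x
    constructor
    · rintro ⟨y, hy, rfl⟩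
      exact hy
    · intro hx
      exact ⟨⟨x, a.2.1.trans hx.1.le, hx.2.trans b.2.2⟩, hx, rfl⟩
  rw [this, Real.volume_Ioc]

theorem timeMeasure_Iic (t : Icc (0 : ℝ) T) :
    timeMeasure T (Iic t) = ENNReal.ofReal t := by
  rw [timeMeasure_apply]
  have : Subtype.val '' Iic t = Icc (0 : ℝ) t := by
    ext x
    constructor
    · rintro ⟨y, hy, rfl⟩
      exact ⟨y.2.1, hy⟩
    · intro hx
      exact ⟨⟨x, hx.1, hx.2.trans t.2.2⟩, hx.2, rfl⟩
  rw [this, Real.volume_Icc, sub_zero]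

theorem ae_timeMeasure_pos : ∀ᵐ s : Icc (0 : ℝ) T ∂timeMeasure T, 0 < (s : ℝ) := by
  rw [ae_iff, timeMeasure_apply]
  refine measure_mono_null (t := {0}) ?_ (by simp)
  rintro _ ⟨s, hs, rfl⟩
  exact le_antisymm (not_lt.1 hs) s.2.1

/-- Integrals over `[0, t]` with respect to `timeMeasure T` are interval integrals. -/
theorem setIntegral_timeMeasure (hT : 0 ≤ T) (h : Icc (0 : ℝ) T → ℝ) (t : Icc (0 : ℝ) T) :
    ∫ s in Iic t, h s ∂timeMeasure T = ∫ s in (0 : ℝ)..t, h (projIcc 0 T hT s) := by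
  rw [intervalIntegral.integral_of_le t.2.1, ← integral_Icc_eq_integral_Ioc]
  have hemb := MeasurableEmbedding.subtype_coe (measurableSet_Icc (a := (0 : ℝ)) (b := T))
  have h1 := hemb.setIntegral_map (μ := timeMeasure T) (fun x : ℝ ↦ h (projIcc 0 T hT x))
    (Iic (t : ℝ))
  have h2 : (timeMeasure T).map Subtype.val = volume.restrict (Icc 0 T) :=
    map_comap_subtype_coe measurableSet_Icc _
  have h3 : (Subtype.val ⁻¹' Iic (t : ℝ) : Set (Icc (0 : ℝ) T)) = Iic t := rfl
  have h4 : Iic (t : ℝ) ∩ Icc 0 T = Icc (0 : ℝ) (t : ℝ) := by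
    ext x
    simp only [mem_inter_iff, mem_Iic, mem_Icc]
    exact ⟨fun hx ↦ ⟨hx.2.1, hx.1⟩, fun hx ↦ ⟨hx.2, hx.1, hx.2.trans t.2.2⟩⟩
  rw [h2, Measure.restrict_restrict measurableSet_Iic, h4, h3] at h1
  simp only [projIcc_val] at h1
  exact h1.symm

end TimeMeasure

section Isometry

variable {𝓕 : Filtration (Icc (0 : ℝ) T) m} {P : Measure Ω}
  {W : Icc (0 : ℝ) T → Ω → ℝ}

theorem IsStandardBrownianMotion.integral_mul_increment (hW : IsStandardBrownianMotion 𝓕 P W)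
    {s t : Icc (0 : ℝ) T} (hst : s ≤ t) {A : Ω → ℝ} (hA : Measurable[𝓕 s] A) {φ : ℝ → ℝ}
    (hφ : Measurable φ) :
    ∫ ω, A ω * φ (W t ω - W s ω) ∂P = (∫ ω, A ω ∂P) * ∫ ω, φ (W t ω - W s ω) ∂P := by
  have hind : A ⟂ᵢ[P] (fun ω ↦ W t ω - W s ω) := by
    rw [IndepFun_iff_Indep]
    exact indep_of_indep_of_le_left (hW.indep_increment s t hst).symm
      (measurable_iff_comap_le.1 hA)
  exact (hind.comp measurable_id hφ).integral_mul_eq_mul_integral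
    (hA.mono (𝓕.le s) le_rfl).aestronglyMeasurable
    (hφ.comp ((hW.measurable t).sub (hW.measurable s))).aestronglyMeasurable

/-- Only the overlap of the two intervals contributes. Any piece of one increment that lies before
the other is measurable at the start of the later one, so the product has mean zero; the common
piece contributes its length, because `A` is measurable at its left end `c`. -/
theorem IsStandardBrownianMotion.integral_mul_increments_of_le
    [IsProbabilityMeasure P] (hT : 0 ≤ T) (hW : IsStandardBrownianMotion 𝓕 P W)
    {a b c d : Icc (0 : ℝ) T} (hcd : c ≤ d) (hac : a ≤ c) {A : Ω → ℝ}
    (hA : Measurable[𝓕 c] A) {C : ℝ} (hC : ∀ ω, |A ω| ≤ C) :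
    ∫ ω, A ω * ((W b ω - W a ω) * (W d ω - W c ω)) ∂P =
      (∫ ω, A ω ∂P) * max 0 (min (b : ℝ) d - max (a : ℝ) c) := by
  have hAm : Measurable A := hA.mono (𝓕.le c) le_rfl
  have hint : ∀ p q r s : Icc (0 : ℝ) T,
      Integrable (fun ω ↦ A ω * ((W p ω - W q ω) * (W r ω - W s ω))) P := fun p q r s ↦ by
    refine Integrable.bdd_mul (c := C) ?_ hAm.aestronglyMeasurable (.of_forall hC)
    exact ((hW.memLp hT p 2 (by simp)).sub (hW.memLp hT q 2 (by simp))).integrable_mul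
      ((hW.memLp hT r 2 (by simp)).sub (hW.memLp hT s 2 (by simp)))
  have hzero : ∀ p q r s : Icc (0 : ℝ) T, c ≤ r → p ≤ r → q ≤ r → r ≤ s →
      ∫ ω, A ω * ((W p ω - W q ω) * (W s ω - W r ω)) ∂P = 0 := fun p q r s hcr hpr hqr hrs ↦ by
    have hmeas : Measurable[𝓕 r] (fun ω ↦ A ω * (W p ω - W q ω)) :=
      (hA.mono (𝓕.mono hcr) le_rfl).mul (((hW.adapted p).mono (𝓕.mono hpr) le_rfl).sub
        ((hW.adapted q).mono (𝓕.mono hqr) le_rfl))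
    have h := hW.integral_mul_increment hrs hmeas measurable_id
    simp only [id, hW.integral_increment hrs, mul_zero] at h
    simpa only [mul_assoc] using h
  have hsq : ∀ s, c ≤ s → ∫ ω, A ω * ((W s ω - W c ω) * (W s ω - W c ω)) ∂P =
      (∫ ω, A ω ∂P) * (s - c) := fun s hs ↦ by
    have h := hW.integral_mul_increment hs hA (measurable_id.pow_const 2)
    simp only [id, hW.integral_increment_sq hs] at h
    simpa only [sq] using h
  have hac' : (a : ℝ) ≤ c := hac
  have hcd' : (c : ℝ) ≤ d := hcd
  rcases le_or_gt b c with hbc | hcb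
  · have hbc' : (b : ℝ) ≤ c := hbc
    rw [hzero b a c d le_rfl hbc hac hcd, max_eq_left, mul_zero]
    rw [max_eq_right hac']
    linarith [min_le_left (b : ℝ) d]
  · have hcb' : (c : ℝ) ≤ b := hcb.le
    have h1 : ∫ ω, A ω * ((W b ω - W a ω) * (W d ω - W c ω)) ∂P =
        ∫ ω, A ω * ((W b ω - W c ω) * (W d ω - W c ω)) ∂P := by
      rw [← sub_eq_zero, ← integral_sub (hint _ _ _ _) (hint _ _ _ _),
        ← hzero c a c d le_rfl le_rfl hac hcd]
      congr 1
      ext ω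
      ring
    rw [h1, max_eq_right hac']
    rcases le_total b d with hbd | hdb
    · have hbd' : (b : ℝ) ≤ d := hbd
      have h2 : ∫ ω, A ω * ((W b ω - W c ω) * (W d ω - W c ω)) ∂P =
          ∫ ω, A ω * ((W b ω - W c ω) * (W b ω - W c ω)) ∂P := by
        rw [← sub_eq_zero, ← integral_sub (hint _ _ _ _) (hint _ _ _ _),
          ← hzero b c b d hcb.le le_rfl hcb.le hbd]
        congr 1
        ext ω
        ring
      rw [h2, hsq b hcb.le, min_eq_left hbd', max_eq_right (by linarith)]
    · have hdb' : (d : ℝ) ≤ b := hdb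
      have h2 : ∫ ω, A ω * ((W b ω - W c ω) * (W d ω - W c ω)) ∂P =
          ∫ ω, A ω * ((W d ω - W c ω) * (W d ω - W c ω)) ∂P := by
        rw [← sub_eq_zero, ← integral_sub (hint _ _ _ _) (hint _ _ _ _),
          ← hzero d c d b hcd le_rfl hcd hdb]
        congr 1
        ext ω
        ring
      rw [h2, hsq d hcd, min_eq_right hdb', max_eq_right (by linarith)]

theorem IsStandardBrownianMotion.integral_mul_increments
    [IsProbabilityMeasure P] (hT : 0 ≤ T) (hW : IsStandardBrownianMotion 𝓕 P W)
    {a b c d : Icc (0 : ℝ) T} (hab : a ≤ b) (hcd : c ≤ d) {ξ η : Ω → ℝ}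
    (hξ : Measurable[𝓕 a] ξ) (hη : Measurable[𝓕 c] η)
    (hξb : ∃ C : ℝ, ∀ ω, |ξ ω| ≤ C) (hηb : ∃ C : ℝ, ∀ ω, |η ω| ≤ C) :
    ∫ ω, (ξ ω * (W b ω - W a ω)) * (η ω * (W d ω - W c ω)) ∂P =
      ∫ ω, ξ ω * η ω * max 0 (min (b : ℝ) d - max (a : ℝ) c) ∂P := by
  obtain ⟨C, hC⟩ := hξb
  obtain ⟨D, hD⟩ := hηb
  have hb : ∀ ω, |ξ ω * η ω| ≤ C * D := fun ω ↦ by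
    rw [abs_mul]
    exact mul_le_mul (hC ω) (hD ω) (abs_nonneg _) ((abs_nonneg _).trans (hC ω))
  rw [integral_mul_const]
  rcases le_total a c with hac | hca
  · refine Eq.trans ?_ (hW.integral_mul_increments_of_le hT hcd hac
      ((hξ.mono (𝓕.mono hac) le_rfl).mul hη) hb)
    congr 1
    ext ω
    ring
  · rw [min_comm, max_comm (a : ℝ)]
    refine Eq.trans ?_ (hW.integral_mul_increments_of_le hT hab hca
      (hξ.mul (hη.mono (𝓕.mono hca) le_rfl)) hb)
    congr 1
    ext ω
    ring

/-- Itô isometry for finite sums of elementary integrands on possibly overlapping intervals. -/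
theorem IsStandardBrownianMotion.lintegral_sum_sq
    [IsProbabilityMeasure P] (hT : 0 ≤ T) (hW : IsStandardBrownianMotion 𝓕 P W) {ι : Type*} [Fintype ι]
    {l r : ι → Icc (0 : ℝ) T} (hlr : ∀ i, l i ≤ r i) {ξ : ι → Ω → ℝ}
    (hξ : ∀ i, Measurable[𝓕 (l i)] (ξ i)) (hξb : ∀ i, ∃ C : ℝ, ∀ ω, |ξ i ω| ≤ C) :
    ∫⁻ ω, ‖∑ i, ξ i ω * (W (r i) ω - W (l i) ω)‖ₑ ^ 2 ∂P =
      ∫⁻ ω, (∫⁻ s, ‖∑ i, (Ioc (l i) (r i)).indicator (fun _ ↦ ξ i ω) s‖ₑ ^ 2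
        ∂timeMeasure T) ∂P := by
  have hξm : ∀ i, Measurable (ξ i) := fun i ↦ (hξ i).mono (𝓕.le _) le_rfl
  have hξ2 : ∀ i, MemLp (ξ i) ∞ P := fun i ↦ by
    obtain ⟨C, hC⟩ := hξb i
    exact memLp_top_of_bound (hξm i).aestronglyMeasurable C (.of_forall hC)
  have hterm : ∀ i, MemLp (fun ω ↦ ξ i ω * (W (r i) ω - W (l i) ω)) 2 P := fun i ↦
    MemLp.mul (q := 2) (p := ∞) ((hW.memLp hT (r i) 2 (by simp)).sub (hW.memLp hT (l i) 2 (by simp)))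
      (hξ2 i)
  have hind : ∀ ω i j, Integrable (fun s ↦ (Ioc (l i) (r i)).indicator (fun _ ↦ ξ i ω) s *
      (Ioc (l j) (r j)).indicator (fun _ ↦ ξ j ω) s) (timeMeasure T) := fun ω i j ↦ by
    simp only [← inter_indicator_mul]
    exact (integrable_const (ξ i ω * ξ j ω)).indicator (measurableSet_Ioc.inter measurableSet_Ioc)
  have hsqint : ∀ ω, Integrable (fun s ↦
      (∑ i, (Ioc (l i) (r i)).indicator (fun _ ↦ ξ i ω) s) ^ 2) (timeMeasure T) := fun ω ↦ by
    simp only [sq, Finset.sum_mul_sum]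
    exact integrable_finsetSum _ fun i _ ↦ integrable_finsetSum _ fun j _ ↦ hind ω i j
  have hreal : ∀ ω, ∫ s, (∑ i, (Ioc (l i) (r i)).indicator (fun _ ↦ ξ i ω) s) ^ 2
      ∂timeMeasure T = ∑ i, ∑ j, ξ i ω * ξ j ω *
        max 0 (min (r i : ℝ) (r j) - max (l i : ℝ) (l j)) := fun ω ↦ by
    simp only [sq, Finset.sum_mul_sum]
    rw [integral_finsetSum _ fun i _ ↦ integrable_finsetSum _ fun j _ ↦ hind ω i j]
    refine Finset.sum_congr rfl fun i _ ↦ ?_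
    rw [integral_finsetSum _ fun j _ ↦ hind ω i j]
    refine Finset.sum_congr rfl fun j _ ↦ ?_
    simp only [← inter_indicator_mul, Ioc_inter_Ioc]
    rw [integral_indicator measurableSet_Ioc, setIntegral_const, measureReal_def,
      timeMeasure_Ioc, ENNReal.toReal_ofReal', smul_eq_mul, mul_comm, max_comm]
    rfl
  have hterm2 : ∀ i j, Integrable (fun ω ↦ (ξ i ω * (W (r i) ω - W (l i) ω)) *
      (ξ j ω * (W (r j) ω - W (l j) ω))) P := fun i j ↦ (hterm i).integrable_mul (hterm j)
  have hξξ : ∀ i j, Integrable (fun ω ↦ ξ i ω * ξ j ω *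
      max 0 (min (r i : ℝ) (r j) - max (l i : ℝ) (l j))) P := fun i j ↦
    (((hξ2 i).mono_exponent le_top : MemLp _ 2 P).integrable_mul
      ((hξ2 j).mono_exponent le_top : MemLp _ 2 P)).mul_const _
  have hleft : ∫ ω, (∑ i, ξ i ω * (W (r i) ω - W (l i) ω)) ^ 2 ∂P =
      ∫ ω, ∑ i, ∑ j, ξ i ω * ξ j ω *
        max 0 (min (r i : ℝ) (r j) - max (l i : ℝ) (l j)) ∂P := by
    simp only [sq, Finset.sum_mul_sum]
    rw [integral_finsetSum _ fun i _ ↦ integrable_finsetSum _ fun j _ ↦ hterm2 i j,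
      integral_finsetSum _ fun i _ ↦ integrable_finsetSum _ fun j _ ↦ hξξ i j]
    refine Finset.sum_congr rfl fun i _ ↦ ?_
    rw [integral_finsetSum _ fun j _ ↦ hterm2 i j, integral_finsetSum _ fun j _ ↦ hξξ i j]
    exact Finset.sum_congr rfl fun j _ ↦ hW.integral_mul_increments hT (hlr i) (hlr j) (hξ i)
      (hξ j) (hξb i) (hξb j)
  have hsumint : Integrable (fun ω ↦ (∑ i, ξ i ω * (W (r i) ω - W (l i) ω)) ^ 2) P := by
    simp only [sq, Finset.sum_mul_sum]
    exact integrable_finsetSum _ fun i _ ↦ integrable_finsetSum _ fun j _ ↦ hterm2 i j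
  simp only [enorm_sq_eq_ofReal]
  rw [← ofReal_integral_eq_lintegral_ofReal hsumint (.of_forall fun ω ↦ sq_nonneg _), hleft]
  simp_rw [← ofReal_integral_eq_lintegral_ofReal (hsqint _) (.of_forall fun s ↦ sq_nonneg _),
    hreal]
  refine ofReal_integral_eq_lintegral_ofReal
    (integrable_finsetSum _ fun i _ ↦ integrable_finsetSum _ fun j _ ↦ hξξ i j)
    (.of_forall fun ω ↦ ?_)
  simp only [Pi.zero_apply, ← hreal]
  exact integral_nonneg fun s ↦ sq_nonneg _

/-- Stopping at `t` cuts every interval at `t`. Coefficients of intervals that begin after `t` need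
not be measurable at the truncated left end; they are replaced by zero, which changes nothing since
those intervals have become empty. -/
theorem IsStandardBrownianMotion.lintegral_sum_sq_stopped
    [IsProbabilityMeasure P] (hT : 0 ≤ T) (hW : IsStandardBrownianMotion 𝓕 P W)
    {ι : Type*} [Fintype ι]
    {l r : ι → Icc (0 : ℝ) T} (hlr : ∀ i, l i ≤ r i) {ξ : ι → Ω → ℝ}
    (hξ : ∀ i, Measurable[𝓕 (l i)] (ξ i)) (hξb : ∀ i, ∃ C : ℝ, ∀ ω, |ξ i ω| ≤ C)
    (t : Icc (0 : ℝ) T) :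
    ∫⁻ ω, ‖∑ i, ξ i ω * (W (min (r i) t) ω - W (min (l i) t) ω)‖ₑ ^ 2 ∂P =
      ∫⁻ ω, (∫⁻ s in Iic t, ‖∑ i, (Ioc (l i) (r i)).indicator (fun _ ↦ ξ i ω) s‖ₑ ^ 2
        ∂timeMeasure T) ∂P := by
  classical
  have h := hW.lintegral_sum_sq hT (l := fun i ↦ min (l i) t) (r := fun i ↦ min (r i) t)
    (fun i ↦ min_le_min_right t (hlr i)) (ξ := fun i ω ↦ if l i ≤ t then ξ i ω else 0)
    (fun i ↦ by
      by_cases hi : l i ≤ t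
      · simp only [hi, if_true]
        exact (hξ i).mono (𝓕.mono (le_min le_rfl hi)) le_rfl
      · simp [hi])
    (fun i ↦ by
      obtain ⟨C, hC⟩ := hξb i
      refine ⟨C, fun ω ↦ ?_⟩
      split_ifs
      · exact hC ω
      · simpa using (abs_nonneg _).trans (hC ω))
  refine Eq.trans (lintegral_congr fun ω ↦ ?_) (h.trans (lintegral_congr fun ω ↦ ?_))
  · congr 3
    ext i
    split_ifs with hi
    · rfl
    · have hi' := (not_le.1 hi).le
      simp [min_eq_right hi', min_eq_right (hi'.trans (hlr i))]
  · rw [← lintegral_indicator measurableSet_Iic]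
    refine lintegral_congr fun s ↦ ?_
    by_cases hs : s ≤ t
    · rw [indicator_of_mem (mem_Iic.2 hs)]
      congr 3
      ext i
      by_cases hi : s ∈ Ioc (l i) (r i)
      · have hi' : s ∈ Ioc (min (l i) t) (min (r i) t) :=
          ⟨(min_le_left _ _).trans_lt hi.1, le_min hi.2 hs⟩
        rw [indicator_of_mem hi, indicator_of_mem hi', if_pos (hi.1.le.trans hs)]
      · rw [indicator_of_notMem hi]
        by_cases hl : l i ≤ t
        · rw [indicator_of_notMem]
          rintro ⟨h1, h2⟩
          rw [min_eq_left hl] at h1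
          exact hi ⟨h1, h2.trans (min_le_left _ _)⟩
        · simp [hl]
    · rw [indicator_of_notMem (by simpa using hs)]
      have : ∀ i, (Ioc (min (l i) t) (min (r i) t)).indicator
          (fun _ ↦ if l i ≤ t then ξ i ω else 0) s = 0 := fun i ↦
        indicator_of_notMem (fun hi ↦ hs (hi.2.trans (min_le_right _ _))) _
      simp [this]

theorem SimpleProcess.measurable_integral {H : SimpleProcess 𝓕}
    (hW : IsStandardBrownianMotion 𝓕 P W) (t : Icc (0 : ℝ) T) :
    Measurable (H.integral W t) :=
  Finset.measurable_sum _ fun i _ ↦ ((H.measurable_ξ i).mono (𝓕.le _) le_rfl).mul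
    ((hW.measurable _).sub (hW.measurable _))

/-- Itô isometry for the difference of two simple processes. -/
theorem SimpleProcess.lintegral_sub_sq
    [IsProbabilityMeasure P] (hT : 0 ≤ T) (hW : IsStandardBrownianMotion 𝓕 P W)
    (G H : SimpleProcess 𝓕) (t : Icc (0 : ℝ) T) :
    ∫⁻ ω, ‖G.integral W t ω - H.integral W t ω‖ₑ ^ 2 ∂P =
      ∫⁻ ω, (∫⁻ s in Iic t, ‖G.eval s ω - H.eval s ω‖ₑ ^ 2 ∂timeMeasure T) ∂P := by
  -- The isometry tolerates overlapping intervals, so the difference is the concatenated family with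
  -- negated coefficients; no common refinement is needed.
  have h := hW.lintegral_sum_sq_stopped hT (ι := Fin G.n ⊕ Fin H.n)
    (l := Sum.elim G.left H.left) (r := Sum.elim G.right H.right)
    (by rintro (i | i); exacts [G.left_le_right i, H.left_le_right i])
    (ξ := Sum.elim G.ξ (fun i ω ↦ -H.ξ i ω))
    (by rintro (i | i); exacts [G.measurable_ξ i, (H.measurable_ξ i).neg])
    (by
      rintro (i | i)
      · exact G.bounded_ξ i
      · simpa using H.bounded_ξ i) t
  refine Eq.trans (lintegral_congr fun ω ↦ ?_)
    (h.trans (lintegral_congr fun ω ↦ lintegral_congr fun s ↦ ?_))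
  · simp only [SimpleProcess.integral, Fintype.sum_sum_type, Sum.elim_inl, Sum.elim_inr,
      neg_mul, Finset.sum_neg_distrib, sub_eq_add_neg]
  · simp only [SimpleProcess.eval, Fintype.sum_sum_type, Sum.elim_inl, Sum.elim_inr]
    rw [sub_eq_add_neg, ← Finset.sum_neg_distrib]
    have : ∀ i, (Ioc (H.left i) (H.right i)).indicator (fun _ ↦ -H.ξ i ω) s =
        -(Ioc (H.left i) (H.right i)).indicator (fun _ ↦ H.ξ i ω) s := fun i ↦
      congrFun (indicator_neg (Ioc (H.left i) (H.right i)) fun _ ↦ H.ξ i ω) s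
    simp only [this]

/-- An Itô integral is the mean-square limit of the elementary integrals of any simple processes
which approximate the integrand uniformly. -/
theorem HasItoIntegral.tendsto_lintegral
    [IsProbabilityMeasure P] (hT : 0 ≤ T) (hW : IsStandardBrownianMotion 𝓕 P W)
    {h : Icc (0 : ℝ) T → Ω → ℝ} {t : Icc (0 : ℝ) T} {Y : Ω → ℝ}
    (hY : HasItoIntegral 𝓕 P W h t Y) {G : ℕ → SimpleProcess 𝓕} {e : ℕ → ℝ}
    (he : Tendsto e atTop (𝓝 0)) (hG : ∀ k, ∀ᵐ ω ∂P, ∀ s ≤ t, 0 < (s : ℝ) → |(G k).eval s ω - h s ω| ≤ e k) :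
    Tendsto (fun k ↦ ∫⁻ ω, ‖(G k).integral W t ω - Y ω‖ₑ ^ 2 ∂P) atTop (𝓝 0) := by
  obtain ⟨-, hYm, H, hH1, hH2⟩ := hY
  have hinner : ∀ k, ∀ᵐ ω ∂P,
      ∫⁻ s in Iic t, ‖(G k).eval s ω - (H k).eval s ω‖ₑ ^ 2 ∂timeMeasure T ≤
      2 * (∫⁻ s in Iic t, ‖(H k).eval s ω - h s ω‖ₑ ^ 2 ∂timeMeasure T) +
        2 * ENNReal.ofReal (e k ^ 2) * ENNReal.ofReal T := fun k ↦ by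
    filter_upwards [hG k] with ω hω
    have hpt : ∀ s ∈ Iic t, 0 < (s : ℝ) → ‖(G k).eval s ω - (H k).eval s ω‖ₑ ^ 2 ≤
        2 * ‖(H k).eval s ω - h s ω‖ₑ ^ 2 + 2 * ENNReal.ofReal (e k ^ 2) := fun s hs hs0 ↦ by
      refine (enorm_sub_sq_le _ (h s ω) _).trans ?_
      rw [add_comm, ← enorm_neg (h s ω - _), neg_sub, enorm_sq_eq_ofReal ((G k).eval s ω - h s ω)]
      gcongr 2 * _ + 2 * ENNReal.ofReal ?_
      rw [← sq_abs]
      exact pow_le_pow_left₀ (abs_nonneg _) (hω s hs hs0) 2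
    -- Time `0` is excluded because simple processes vanish there, their intervals being open on the
    -- left; it is a null set.
    refine (setLIntegral_mono_ae' measurableSet_Iic (by
      filter_upwards [ae_timeMeasure_pos] with s hs0 hs using hpt s hs hs0)).trans ?_
    rw [lintegral_add_right _ measurable_const, lintegral_const_mul' _ _ (by simp)]
    gcongr
    rw [lintegral_const]
    gcongr
    rw [Measure.restrict_apply_univ, timeMeasure_Iic]
    exact ENNReal.ofReal_le_ofReal t.2.2
  have hbound : ∀ k, ∫⁻ ω, ‖(G k).integral W t ω - Y ω‖ₑ ^ 2 ∂P ≤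
      2 * (2 * (∫⁻ ω, (∫⁻ s in Iic t, ‖(H k).eval s ω - h s ω‖ₑ ^ 2 ∂timeMeasure T) ∂P) +
        2 * ENNReal.ofReal (e k ^ 2) * ENNReal.ofReal T) +
      2 * ∫⁻ ω, ‖(H k).integral W t ω - Y ω‖ₑ ^ 2 ∂P := fun k ↦ by
    refine (lintegral_mono fun ω ↦ enorm_sub_sq_le _ ((H k).integral W t ω) _).trans ?_
    have hm : Measurable fun ω ↦ 2 * ‖(G k).integral W t ω - (H k).integral W t ω‖ₑ ^ 2 :=
      (((SimpleProcess.measurable_integral hW t).sub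
        (SimpleProcess.measurable_integral hW t)).enorm.pow_const 2).const_mul 2
    rw [lintegral_add_left hm, lintegral_const_mul' _ _ (by simp),
      lintegral_const_mul' _ _ (by simp), SimpleProcess.lintegral_sub_sq hT hW]
    gcongr
    refine (lintegral_mono_ae (hinner k)).trans ?_
    rw [lintegral_add_right _ measurable_const, lintegral_const_mul' _ _ (by simp)]
    simp
  refine tendsto_of_tendsto_of_tendsto_of_le_of_le tendsto_const_nhds ?_ (fun _ ↦ zero_le)
    hbound
  have he2 : Tendsto (fun k ↦ ENNReal.ofReal (e k ^ 2)) atTop (𝓝 0) := by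
    have := ENNReal.tendsto_ofReal (he.pow 2)
    simpa using this
  have h1 := ENNReal.Tendsto.const_mul (a := 2) hH1 (Or.inr (by simp))
  have h2 := ENNReal.Tendsto.mul_const (b := ENNReal.ofReal T)
    (ENNReal.Tendsto.const_mul (a := 2) he2 (Or.inr (by simp))) (Or.inr (by simp))
  have h3 := ENNReal.Tendsto.const_mul (a := 2) (h1.add h2) (Or.inr (by simp))
  have h4 := ENNReal.Tendsto.const_mul (a := 2) hH2 (Or.inr (by simp))
  simpa using h3.add h4

/-- A pathwise limit must agree with the mean-square limit, by Fatou's lemma. This turns stochastic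
integrals into explicit functionals of the path. -/
theorem HasItoIntegral.ae_eq_of_tendsto
    [IsProbabilityMeasure P] (hT : 0 ≤ T) (hW : IsStandardBrownianMotion 𝓕 P W)
    {h : Icc (0 : ℝ) T → Ω → ℝ} {t : Icc (0 : ℝ) T} {Y : Ω → ℝ}
    (hY : HasItoIntegral 𝓕 P W h t Y) {G : ℕ → SimpleProcess 𝓕} {e : ℕ → ℝ}
    (he : Tendsto e atTop (𝓝 0)) (hG : ∀ k, ∀ᵐ ω ∂P, ∀ s ≤ t, 0 < (s : ℝ) → |(G k).eval s ω - h s ω| ≤ e k)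
    {J : Ω → ℝ} (hJ : ∀ᵐ ω ∂P, Tendsto (fun k ↦ (G k).integral W t ω) atTop (𝓝 (J ω))) :
    Y =ᵐ[P] J := by
  have hlim := hY.tendsto_lintegral hT hW he hG
  have hYm := hY.2.1
  have hm : ∀ k, AEMeasurable (fun ω ↦ ‖(G k).integral W t ω - Y ω‖ₑ ^ 2) P := fun k ↦
    (((SimpleProcess.measurable_integral hW t).aemeasurable.sub hYm).enorm.pow_const 2)
  have hfatou := lintegral_liminf_le' (u := atTop) hm
  rw [hlim.liminf_eq] at hfatou
  have hzero : ∫⁻ ω, ‖J ω - Y ω‖ₑ ^ 2 ∂P = 0 := by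
    refine le_antisymm (le_trans (le_of_eq (lintegral_congr_ae ?_)) hfatou) zero_le
    filter_upwards [hJ] with ω hω
    have : Tendsto (fun k ↦ ‖(G k).integral W t ω - Y ω‖ₑ ^ 2) atTop (𝓝 (‖J ω - Y ω‖ₑ ^ 2)) :=
      ((ENNReal.continuous_pow 2).tendsto _).comp
        ((continuous_enorm.tendsto _).comp (hω.sub_const (Y ω)))
    exact this.liminf_eq.symm
  have hJm : AEMeasurable J P := aemeasurable_of_tendsto_metrizable_ae atTop
    (fun k ↦ (SimpleProcess.measurable_integral hW t).aemeasurable) hJ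
  have hzero' := (lintegral_eq_zero_iff' ((hJm.sub hYm).enorm.pow_const 2)).1 hzero
  filter_upwards [hzero'] with ω hω
  have : ‖J ω - Y ω‖ₑ = 0 := by simpa using hω
  rw [enorm_eq_zero, sub_eq_zero] at this
  exact this.symm

end Isometry

end ItoIsometry

/-! ### Wiener integrals as pathwise limits of Riemann–Stieltjes sums. -/

section PathwiseIntegral

variable {Ω : Type*} {m : MeasurableSpace Ω} {T : ℝ}

section Partition

/-- The nodes of the partition of `[c, d]` into `k + 1` intervals of equal length. -/
def node (c d : ℝ) (k i : ℕ) : ℝ := c + i * ((d - c) / (k + 1))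

theorem node_zero (c d : ℝ) (k : ℕ) : node c d k 0 = c := by simp [node]

theorem node_last (c d : ℝ) (k : ℕ) : node c d k (k + 1) = d := by
  have : (k : ℝ) + 1 ≠ 0 := by positivity
  simp only [node]
  push_cast
  field_simp
  ring

theorem node_succ_sub (c d : ℝ) (k i : ℕ) :
    node c d k (i + 1) - node c d k i = (d - c) / (k + 1) := by
  simp only [node]
  push_cast
  ring

theorem monotone_node {c d : ℝ} (hcd : c ≤ d) (k : ℕ) : Monotone (node c d k) :=
  monotone_nat_of_le_succ fun i ↦ by
    have : 0 ≤ (d - c) / (k + 1) := div_nonneg (sub_nonneg.2 hcd) (by positivity)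
    linarith [node_succ_sub c d k i]

theorem node_mem {c d : ℝ} (hcd : c ≤ d) {k i : ℕ} (hi : i ≤ k + 1) :
    node c d k i ∈ Icc c d := by
  constructor
  · simpa only [node_zero] using monotone_node hcd k (Nat.zero_le i)
  · simpa only [node_last] using monotone_node hcd k hi

theorem tendsto_mesh (x : ℝ) : Tendsto (fun k : ℕ ↦ x / ((k : ℝ) + 1)) atTop (𝓝 0) :=
  tendsto_const_div_atTop_nhds_zero_nat x |>.comp (tendsto_add_atTop_nat 1) |>.congr fun k ↦ by
    simp

/-- Uniform continuity of `w` on `[c, d]` makes the integrands uniformly small. Both Riemann and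
Stieltjes sums differ from their limits by an expression of this form. -/
theorem tendsto_sum_integral_sub {c d : ℝ} (hcd : c ≤ d) {ρ w : ℝ → ℝ} (hρ : Continuous ρ)
    (hw : Continuous w) {p : ℕ → ℕ → ℝ}
    (hp : ∀ k i, p k i ∈ Icc (node c d k i) (node c d k (i + 1))) :
    Tendsto (fun k ↦ ∑ i ∈ Finset.range (k + 1),
      ∫ s in node c d k i..node c d k (i + 1), ρ s * (w s - w (p k i))) atTop (𝓝 0) := by
  obtain ⟨M, hM⟩ := (isCompact_Icc (a := c) (b := d)).exists_bound_of_continuousOn hρ.continuousOn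
  have hM0 : 0 ≤ M := (norm_nonneg _).trans (hM c (left_mem_Icc.2 hcd))
  have huc := (isCompact_Icc (a := c) (b := d)).uniformContinuousOn_of_continuous hw.continuousOn
  rw [Metric.uniformContinuousOn_iff_le] at huc
  rw [Metric.tendsto_atTop]
  intro ε hε
  -- The summands `1` keep the denominator positive when `M = 0` or `c = d`, and make the final
  -- estimate strict.
  have hε' : 0 < ε / ((M + 1) * (d - c + 1)) := by
    have : 0 < d - c + 1 := by linarith
    positivity
  obtain ⟨η, hη, hη'⟩ := huc _ hε'
  obtain ⟨N, hN⟩ := (Metric.tendsto_atTop.1 (tendsto_mesh (d - c))) η hη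
  refine ⟨N, fun k hk ↦ ?_⟩
  have hmesh : (d - c) / ((k : ℝ) + 1) ≤ η := by
    have := (hN k hk).le
    rw [Real.dist_eq, sub_zero] at this
    exact (le_abs_self _).trans this
  have hterm : ∀ i ∈ Finset.range (k + 1),
      ‖∫ s in node c d k i..node c d k (i + 1), ρ s * (w s - w (p k i))‖ ≤
        M * (ε / ((M + 1) * (d - c + 1))) * ((d - c) / (k + 1)) := fun i hi ↦ by
    have hi' : i + 1 ≤ k + 1 := Finset.mem_range.1 hi
    have hle := monotone_node hcd k i.le_succ
    have hn1 := node_mem hcd (i.le_succ.trans hi')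
    have hn2 := node_mem hcd hi'
    have hb : ∀ s ∈ uIoc (node c d k i) (node c d k (i + 1)), ‖ρ s * (w s - w (p k i))‖ ≤
        M * (ε / ((M + 1) * (d - c + 1))) := fun s hs ↦ by
      rw [uIoc_of_le hle] at hs
      have hs' : s ∈ Icc c d := ⟨hn1.1.trans hs.1.le, hs.2.trans hn2.2⟩
      have hp' : p k i ∈ Icc c d := ⟨hn1.1.trans (hp k i).1, (hp k i).2.trans hn2.2⟩
      rw [norm_mul]
      refine mul_le_mul (hM s hs') ?_ (norm_nonneg _) hM0
      rw [← dist_eq_norm]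
      refine hη' s hs' _ hp' (le_trans ?_ hmesh)
      rw [← node_succ_sub c d k i, Real.dist_eq, abs_le]
      constructor <;> linarith [hs.1, hs.2, (hp k i).1, (hp k i).2]
    have := intervalIntegral.norm_integral_le_of_norm_le_const hb
    rwa [node_succ_sub, abs_of_nonneg (div_nonneg (sub_nonneg.2 hcd) (by positivity))] at this
  rw [dist_zero_right]
  refine (norm_sum_le _ _).trans_lt ((Finset.sum_le_sum hterm).trans_lt ?_)
  rw [Finset.sum_const, Finset.card_range, nsmul_eq_mul]
  have h1 : (0 : ℝ) < d - c + 1 := by linarith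
  have h2 : (0 : ℝ) < (k : ℝ) + 1 := by positivity
  have h3 : (↑(k + 1) : ℝ) * (M * (ε / ((M + 1) * (d - c + 1))) * ((d - c) / (k + 1))) =
      ε * (M / (M + 1)) * ((d - c) / (d - c + 1)) := by
    push_cast
    field_simp
  rw [h3]
  have h4 : M / (M + 1) < 1 := (div_lt_one (by linarith)).2 (by linarith)
  have h5 : (d - c) / (d - c + 1) < 1 := (div_lt_one h1).2 (by linarith)
  have h6 : 0 ≤ M / (M + 1) := by positivity
  have h7 : 0 ≤ (d - c) / (d - c + 1) := div_nonneg (by linarith) h1.le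
  calc ε * (M / (M + 1)) * ((d - c) / (d - c + 1)) ≤ ε * (M / (M + 1)) * 1 := by gcongr
    _ < ε := by nlinarith

/-- Convergence of the Riemann–Stieltjes sums `∑ φ(t_i) (w(t_{i+1}) - w(t_i))`. -/
theorem tendsto_stieltjes_sum {c d : ℝ} (hcd : c ≤ d) {φ w : ℝ → ℝ} (hφ : ContDiff ℝ 1 φ)
    (hw : Continuous w) :
    Tendsto (fun k ↦ ∑ i ∈ Finset.range (k + 1),
      φ (node c d k i) * (w (node c d k (i + 1)) - w (node c d k i))) atTop
      (𝓝 (φ d * w d - φ c * w c - ∫ s in c..d, deriv φ s * w s)) := by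
  have hφ' : Continuous (deriv φ) := hφ.continuous_deriv le_rfl
  -- Summation by parts: the sum minus its limit is the sum over the cells of `∫ φ' (w -
  -- w(t_{i+1}))`, hence right end points.
  have h := tendsto_sum_integral_sub hcd hφ' hw (p := fun k i ↦ node c d k (i + 1))
    fun k i ↦ right_mem_Icc.2 (monotone_node hcd k i.le_succ)
  have h2 := h.add_const (φ d * w d - φ c * w c - ∫ s in c..d, deriv φ s * w s)
  rw [zero_add] at h2
  refine h2.congr fun k ↦ ?_
  have hint : ∀ a b, IntervalIntegrable (fun s ↦ deriv φ s * w s) volume a b := fun a b ↦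
    (hφ'.mul hw).intervalIntegrable a b
  have hterm : ∀ i, ∫ s in node c d k i..node c d k (i + 1),
      deriv φ s * (w s - w (node c d k (i + 1))) =
      (∫ s in node c d k i..node c d k (i + 1), deriv φ s * w s) -
        (φ (node c d k (i + 1)) - φ (node c d k i)) * w (node c d k (i + 1)) := fun i ↦ by
    simp_rw [mul_sub]
    rw [intervalIntegral.integral_sub (hint _ _)
      ((hφ'.intervalIntegrable _ _).mul_const _), intervalIntegral.integral_mul_const,
      intervalIntegral.integral_deriv_eq_sub (fun x _ ↦ (hφ.differentiable (by simp)).differentiableAt)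
        (hφ'.intervalIntegrable _ _)]
  simp_rw [hterm]
  rw [Finset.sum_sub_distrib, intervalIntegral.sum_integral_adjacent_intervals
    (fun i _ ↦ hint _ _), node_zero, node_last]
  have htel : φ d * w d - φ c * w c = ∑ i ∈ Finset.range (k + 1),
      (φ (node c d k (i + 1)) * w (node c d k (i + 1)) - φ (node c d k i) * w (node c d k i)) := by
    rw [Finset.sum_range_sub (fun i ↦ φ (node c d k i) * w (node c d k i)), node_zero, node_last]
  rw [htel]
  have : ∀ A B C : ℝ, A - B + (C - A) = C - B := fun A B C ↦ by ring
  rw [this, ← Finset.sum_sub_distrib]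
  exact Finset.sum_congr rfl fun i _ ↦ by ring

/-- Convergence of the Riemann sums of a continuous function. -/
theorem tendsto_riemann_sum {c d : ℝ} (hcd : c ≤ d) {w : ℝ → ℝ} (hw : Continuous w) :
    Tendsto (fun k ↦ ∑ i ∈ Finset.range (k + 1),
      w (node c d k i) * (node c d k (i + 1) - node c d k i)) atTop (𝓝 (∫ s in c..d, w s)) := by
  have h := tendsto_sum_integral_sub hcd continuous_const (ρ := fun _ ↦ (-1 : ℝ)) hw
    (p := fun k i ↦ node c d k i)
    fun k i ↦ left_mem_Icc.2 (monotone_node hcd k i.le_succ)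
  have h2 := h.add_const (∫ s in c..d, w s)
  rw [zero_add] at h2
  refine h2.congr fun k ↦ ?_
  have hint : ∀ a b, IntervalIntegrable w volume a b := fun a b ↦ hw.intervalIntegrable a b
  have hterm : ∀ i, ∫ s in node c d k i..node c d k (i + 1), -1 * (w s - w (node c d k i)) =
      w (node c d k i) * (node c d k (i + 1) - node c d k i) -
      (∫ s in node c d k i..node c d k (i + 1), w s) := fun i ↦ by
    rw [intervalIntegral.integral_const_mul, intervalIntegral.integral_sub (hint _ _)
      (by simp), intervalIntegral.integral_const, smul_eq_mul]
    ring
  simp_rw [hterm]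
  rw [Finset.sum_sub_distrib, intervalIntegral.sum_integral_adjacent_intervals
    (fun i _ ↦ hint _ _), node_zero, node_last]
  ring

end Partition

section WienerIntegral

variable {𝓕 : Filtration (Icc (0 : ℝ) T) m} {P : Measure Ω} {W : Icc (0 : ℝ) T → Ω → ℝ}

/-- The Wiener integral `∫_c^d φ dW` of a continuously differentiable function, in the form which
integration by parts gives for every path. -/
def wienerIntegral (hT : 0 ≤ T) (W : Icc (0 : ℝ) T → Ω → ℝ) (φ : ℝ → ℝ) (c d : ℝ) (ω : Ω) : ℝ :=
  φ d * W (projIcc 0 T hT d) ω - φ c * W (projIcc 0 T hT c) ω -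
    ∫ s in c..d, deriv φ s * W (projIcc 0 T hT s) ω

theorem tendsto_wienerIntegral (hT : 0 ≤ T) (hW : ∀ ω, Continuous fun t ↦ W t ω)
    {φ : ℝ → ℝ} (hφ : ContDiff ℝ 1 φ) {c d : ℝ} (hcd : c ≤ d) (ω : Ω) :
    Tendsto (fun k ↦ ∑ i ∈ Finset.range (k + 1), φ (node c d k i) *
      (W (projIcc 0 T hT (node c d k (i + 1))) ω - W (projIcc 0 T hT (node c d k i)) ω)) atTop
      (𝓝 (wienerIntegral hT W φ c d ω)) :=
  tendsto_stieltjes_sum hcd hφ ((hW ω).comp continuous_projIcc)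

/-- The approximating sums are centred Gaussian with variances equal to the Riemann sums of `φ²`.
Their characteristic functions converge both to that of the pathwise limit, by dominated
convergence, and to the Gaussian one. -/
theorem IsStandardBrownianMotion.hasLaw_wienerIntegral [IsProbabilityMeasure P] (hT : 0 ≤ T)
    (hW : IsStandardBrownianMotion 𝓕 P W) {φ : ℝ → ℝ} (hφ : ContDiff ℝ 1 φ) {c d : ℝ}
    (hc : 0 ≤ c) (hcd : c ≤ d) (hd : d ≤ T) :
    HasLaw (wienerIntegral hT W φ c d) (gaussianReal 0 (Real.toNNReal (∫ s in c..d, φ s ^ 2))) P := by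
  have hlim := fun ω ↦ tendsto_wienerIntegral hT hW.continuous_path hφ hcd ω
  set S : ℕ → Ω → ℝ := fun k ω ↦ ∑ i ∈ Finset.range (k + 1), φ (node c d k i) *
      (W (projIcc 0 T hT (node c d k (i + 1))) ω - W (projIcc 0 T hT (node c d k i)) ω) with hS
  have hSm : ∀ k, Measurable (S k) := fun k ↦ Finset.measurable_sum _ fun i _ ↦
    ((hW.measurable _).sub (hW.measurable _)).const_mul _
  have hJm : Measurable (wienerIntegral hT W φ c d) :=
    measurable_of_tendsto_metrizable hSm (tendsto_pi_nhds.2 hlim)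
  have hval : ∀ k, ∑ i ∈ Finset.range (k + 1), φ (node c d k i) ^ 2 *
        ((projIcc 0 T hT (node c d k (i + 1)) : ℝ) - projIcc 0 T hT (node c d k i)) =
      ∑ i ∈ Finset.range (k + 1), φ (node c d k i) ^ 2 *
        (node c d k (i + 1) - node c d k i) := fun k ↦ by
    refine Finset.sum_congr rfl fun i hi ↦ ?_
    have h1 := node_mem hcd (Finset.mem_range.1 hi : i + 1 ≤ k + 1)
    have h2 := node_mem hcd (Finset.mem_range.1 hi).le
    rw [projIcc_of_mem hT ⟨hc.trans h1.1, h1.2.trans hd⟩,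
      projIcc_of_mem hT ⟨hc.trans h2.1, h2.2.trans hd⟩]
  have hlaw : ∀ k, HasLaw (S k) (gaussianReal 0 (Real.toNNReal (∑ i ∈ Finset.range (k + 1),
      φ (node c d k i) ^ 2 * (node c d k (i + 1) - node c d k i)))) P := fun k ↦ by
    rw [← hval]
    exact hW.hasLaw_sum_increments ((monotone_projIcc hT).comp (monotone_node hcd k)) _ _
  refine ⟨hJm.aemeasurable, ?_⟩
  have := Measure.isProbabilityMeasure_map (μ := P) hJm.aemeasurable
  refine Measure.ext_of_charFun (funext fun x ↦ ?_)
  have hv := (NNReal.continuous_coe.comp continuous_real_toNNReal).continuousAt.tendsto.comp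
    (tendsto_riemann_sum hcd (hφ.continuous.pow 2))
  have h1 : Tendsto (fun k ↦ charFun (P.map (S k)) x) atTop (𝓝 (charFun (gaussianReal 0
      (Real.toNNReal (∫ s in c..d, φ s ^ 2))) x)) := by
    simp_rw [(hlaw _).map_eq, charFun_gaussianReal]
    refine (Complex.continuous_exp.tendsto _).comp (tendsto_const_nhds.sub ?_)
    refine Tendsto.div_const (Tendsto.mul_const _ ?_) _
    exact (Complex.continuous_ofReal.tendsto _).comp hv
  have h2 : Tendsto (fun k ↦ charFun (P.map (S k)) x) atTop
      (𝓝 (charFun (P.map (wienerIntegral hT W φ c d)) x)) := by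
    simp_rw [charFun_apply_real]
    have hmap : ∀ {Y : Ω → ℝ}, Measurable Y → ∫ y, Complex.exp (x * y * Complex.I) ∂P.map Y =
        ∫ ω, Complex.exp (x * Y ω * Complex.I) ∂P := fun hY ↦
      integral_map hY.aemeasurable (by fun_prop)
    rw [hmap hJm]
    simp_rw [hmap (hSm _)]
    refine tendsto_integral_of_dominated_convergence (fun _ ↦ 1) (fun k ↦ ?_)
      (integrable_const _) (fun k ↦ .of_forall fun ω ↦ ?_) (.of_forall fun ω ↦ ?_)
    · have := hSm k
      exact Measurable.aestronglyMeasurable (by fun_prop)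
    · rw [← Complex.ofReal_mul, Complex.norm_exp_ofReal_mul_I]
    · refine (Complex.continuous_exp.tendsto _).comp (Tendsto.mul_const _ (Tendsto.const_mul _ ?_))
      exact (Complex.continuous_ofReal.tendsto _).comp (hlim ω)
  exact tendsto_nhds_unique h2 h1

/-- The Riemann approximation of a deterministic integrand on `[0, t]` as a simple process. -/
def stepProcess (𝓕 : Filtration (Icc (0 : ℝ) T) m) (hT : 0 ≤ T) (φ : ℝ → ℝ)
    (t : Icc (0 : ℝ) T) (k : ℕ) : SimpleProcess 𝓕 where
  n := k + 1
  left i := projIcc 0 T hT (node 0 t k i)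
  right i := projIcc 0 T hT (node 0 t k (i + 1))
  left_le_right _ := monotone_projIcc hT (monotone_node t.2.1 k (Nat.le_succ _))
  ξ i _ := φ (node 0 t k i)
  measurable_ξ _ := measurable_const
  bounded_ξ i := ⟨|φ (node 0 t k i)|, fun _ ↦ le_rfl⟩

theorem stepProcess_integral (hT : 0 ≤ T) (φ : ℝ → ℝ) (t : Icc (0 : ℝ) T) (k : ℕ) (ω : Ω) :
    (stepProcess 𝓕 hT φ t k).integral W t ω = ∑ i ∈ Finset.range (k + 1), φ (node 0 t k i) *
      (W (projIcc 0 T hT (node 0 t k (i + 1))) ω - W (projIcc 0 T hT (node 0 t k i)) ω) := by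
  have hle : ∀ i ≤ k + 1, projIcc 0 T hT (node 0 t k i) ≤ t := fun i hi ↦ by
    have := monotone_projIcc hT (node_mem t.2.1 hi).2
    rwa [projIcc_val] at this
  rw [Finset.sum_range]
  simp only [SimpleProcess.integral, stepProcess]
  refine Finset.sum_congr rfl fun i _ ↦ ?_
  rw [min_eq_left (hle _ i.2), min_eq_left (hle _ i.2.le)]

theorem stepProcess_eval (hT : 0 ≤ T) (φ : ℝ → ℝ) {t s : Icc (0 : ℝ) T} (hs : s ≤ t)
    (hs0 : 0 < (s : ℝ)) (k : ℕ) (ω : Ω) :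
    ∃ i < k + 1, (s : ℝ) ∈ Icc (node 0 t k i) (node 0 t k (i + 1)) ∧
      (stepProcess 𝓕 hT φ t k).eval s ω = φ (node 0 t k i) := by
  classical
  have hval : ∀ i ≤ k + 1, (projIcc 0 T hT (node 0 t k i) : ℝ) = node 0 t k i := fun i hi ↦ by
    have h := node_mem t.2.1 hi
    rw [projIcc_of_mem hT ⟨h.1, h.2.trans t.2.2⟩]
  have hmono := (monotone_projIcc hT).comp (monotone_node t.2.1 k)
  -- The cell containing `s` ends at the first node not below `s`; positivity of `s` ensures that
  -- this is not node `0`.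
  have hex : ∃ i, s ≤ projIcc 0 T hT (node 0 t k i) :=
    ⟨k + 1, by rw [node_last, projIcc_val]; exact hs⟩
  obtain ⟨i, hi⟩ : ∃ i, Nat.find hex = i + 1 := by
    refine Nat.exists_eq_succ_of_ne_zero fun h0 ↦ ?_
    have := Nat.find_spec hex
    rw [h0] at this
    have h' : (s : ℝ) ≤ projIcc 0 T hT (node 0 t k 0) := this
    rw [hval 0 (Nat.zero_le _), node_zero] at h'
    exact hs0.not_ge h'
  have hik : i + 1 ≤ k + 1 := hi ▸ Nat.find_min' hex (by rw [node_last, projIcc_val]; exact hs)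
  have hupper : s ≤ projIcc 0 T hT (node 0 t k (i + 1)) := hi ▸ Nat.find_spec hex
  have hlower : projIcc 0 T hT (node 0 t k i) < s :=
    not_le.1 (Nat.find_min hex (by omega))
  refine ⟨i, hik, ⟨?_, ?_⟩, ?_⟩
  · rw [← hval i (by omega)]
    exact hlower.le
  · rw [← hval _ hik]
    exact hupper
  · simp only [SimpleProcess.eval, stepProcess]
    rw [Finset.sum_eq_single (⟨i, hik⟩ : Fin (k + 1))]
    · exact indicator_of_mem (show s ∈ Ioc _ _ from ⟨hlower, hupper⟩) _
    · intro j _ hj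
      refine indicator_of_notMem (fun hmem ↦ ?_) _
      rcases lt_or_gt_of_ne (fun h ↦ hj (Fin.ext h) : (j : ℕ) ≠ i) with h | h
      · exact (hmem.2.trans (hmono (show (j : ℕ) + 1 ≤ i by omega))).not_gt hlower
      · exact (hupper.trans (hmono (show i + 1 ≤ (j : ℕ) by omega))).not_gt hmem.1
    · exact fun h ↦ absurd (Finset.mem_univ _) h

/-- The Itô integral of a deterministic continuously differentiable integrand is its Wiener
integral. -/
theorem HasItoIntegral.ae_eq_wienerIntegral [IsProbabilityMeasure P] (hT : 0 ≤ T)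
    (hW : IsStandardBrownianMotion 𝓕 P W) {h : Icc (0 : ℝ) T → Ω → ℝ} {t : Icc (0 : ℝ) T}
    {Y : Ω → ℝ} (hY : HasItoIntegral 𝓕 P W h t Y) {φ : ℝ → ℝ} (hφ : ContDiff ℝ 1 φ)
    (hh : ∀ᵐ ω ∂P, ∀ s ≤ t, h s ω = φ s) :
    Y =ᵐ[P] wienerIntegral hT W φ 0 t := by
  obtain ⟨M, hM⟩ := (isCompact_Icc (a := 0) (b := T)).exists_bound_of_continuousOn
    (hφ.continuous_deriv le_rfl).continuousOn
  have hM0 : 0 ≤ M := (norm_nonneg _).trans (hM 0 (left_mem_Icc.2 hT))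
  refine hY.ae_eq_of_tendsto hT hW (G := stepProcess 𝓕 hT φ t)
    (e := fun k ↦ M * (t / (k + 1))) ?_ (fun k ↦ ?_) (.of_forall fun ω ↦ ?_)
  · simpa using (tendsto_mesh (t : ℝ)).const_mul M
  · filter_upwards [hh] with ω hω s hs hs0
    obtain ⟨i, hi, hsi, heval⟩ := stepProcess_eval (𝓕 := 𝓕) hT φ hs hs0 k ω
    have hni := node_mem t.2.1 hi.le
    -- The mean value inequality bounds the error by `M` times the mesh `t / (k + 1)`.
    rw [heval, hω s hs]
    have := (convex_Icc (0 : ℝ) T).norm_image_sub_le_of_norm_deriv_le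
      (fun x _ ↦ (hφ.differentiable (by simp)).differentiableAt) hM
      s.2 (⟨hni.1, hni.2.trans t.2.2⟩ : node 0 t k i ∈ Icc 0 T)
    refine this.trans (mul_le_mul_of_nonneg_left ?_ hM0)
    have hlen := node_succ_sub 0 t k i
    rw [sub_zero] at hlen
    rw [Real.norm_eq_abs, abs_le]
    constructor <;> linarith [hsi.1, hsi.2]
  · simp_rw [stepProcess_integral]
    exact tendsto_wienerIntegral hT hW.continuous_path hφ t.2.1 ω

end WienerIntegral

end PathwiseIntegral

/-! ### The equation for the second component and its terminal value. -/

section Ode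

variable {T τ₁ τ₂ : ℝ} {g : ℝ → ℝ}

theorem exists_lipschitzWith_of_const_outside (hg : ContDiff ℝ 1 g) {a b : ℝ}
    (hga : g '' Iic τ₁ = {a}) (hgb : g '' Ici τ₂ = {b}) : ∃ K, LipschitzWith K g := by
  have hga' : ∀ x ≤ τ₁, g x = a := fun x hx ↦ by
    have : g x ∈ g '' Iic τ₁ := mem_image_of_mem g hx
    rwa [hga] at this
  have hgb' : ∀ x, τ₂ ≤ x → g x = b := fun x hx ↦ by
    have : g x ∈ g '' Ici τ₂ := mem_image_of_mem g hx
    rwa [hgb] at this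
  obtain ⟨M, hM⟩ := (isCompact_Icc (a := τ₁) (b := τ₂)).exists_bound_of_continuousOn
    (hg.continuous_deriv le_rfl).continuousOn
  refine ⟨Real.toNNReal (max M 0), lipschitzWith_of_nnnorm_deriv_le (hg.differentiable (by simp))
    fun x ↦ ?_⟩
  rw [← NNReal.coe_le_coe, coe_nnnorm, Real.coe_toNNReal _ (le_max_right _ _)]
  rcases lt_or_ge x τ₁ with hx | hx
  · have : g =ᶠ[𝓝 x] fun _ ↦ a := by
      filter_upwards [Iio_mem_nhds hx] with z hz using hga' z (le_of_lt hz)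
    rw [this.deriv_eq]
    simp
  rcases lt_or_ge τ₂ x with hx' | hx'
  · have : g =ᶠ[𝓝 x] fun _ ↦ b := by
      filter_upwards [Ioi_mem_nhds hx'] with z hz using hgb' z (le_of_lt hz)
    rw [this.deriv_eq]
    simp
  · exact (hM x ⟨hx, hx'⟩).trans (le_max_left _ _)

theorem hasDerivAt_integral_of_continuous {h : ℝ → ℝ} (hh : Continuous h) (a t : ℝ) :
    HasDerivAt (fun u ↦ ∫ s in a..u, h s) (h t) t :=
  intervalIntegral.integral_hasDerivAt_right (hh.intervalIntegrable _ _)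
    (hh.stronglyMeasurableAtFilter _ _) hh.continuousAt

/-- As long as `t ≤ τ₁`, the second component of the equation moves with unit speed. -/
theorem eq_id_of_le (hτ₁ : τ₁ ≤ T) {K : ℝ≥0} (hgL : LipschitzWith K g)
    (hg0 : ∀ x ≤ τ₁, g x = 0) {y q : ℝ → ℝ} (hy : Continuous y) (hq : Continuous q)
    (hq2 : ∀ t, q t ∈ Icc 0 2)
    (heq : ∀ t ∈ Icc 0 T, y t = t + ∫ s in (0 : ℝ)..t, g (y s) * q s) {t : ℝ}
    (ht : t ∈ Icc 0 τ₁) : y t = t := by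
  set z : ℝ → ℝ := fun t ↦ t + ∫ s in (0 : ℝ)..t, g (y s) * q s with hz
  have hzd : ∀ t, HasDerivAt z (1 + g (y t) * q t) t := fun t ↦
    (hasDerivAt_id t).add (hasDerivAt_integral_of_continuous ((hgL.continuous.comp hy).mul hq) 0 t)
  have hlip : ∀ t, LipschitzWith (K * 2) fun x ↦ 1 + g x * q t := fun t ↦ by
    refine LipschitzWith.of_dist_le_mul fun x x' ↦ ?_
    have h1 := hgL.dist_le_mul x x'
    rw [Real.dist_eq] at h1 ⊢
    have h2 : 1 + g x * q t - (1 + g x' * q t) = (g x - g x') * q t := by ring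
    rw [h2, abs_mul, abs_of_nonneg (hq2 t).1]
    push_cast
    calc |g x - g x'| * q t ≤ (K * dist x x') * 2 :=
          mul_le_mul h1 (hq2 t).2 (hq2 t).1 (by positivity)
      _ = K * 2 * dist x x' := by ring
  have hzy : ∀ t ∈ Icc 0 τ₁, z t = y t := fun t ht ↦ (heq t ⟨ht.1, ht.2.trans hτ₁⟩).symm
  -- `z` agrees with `y` on `[0, τ₁]` and is differentiable everywhere. Both `z` and the identity
  -- solve `x' = 1 + g(x) q(t)`, the latter because `g` vanishes up to `τ₁`.
  have h := ODE_solution_unique hlip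
    (continuous_iff_continuousAt.2 fun t ↦ (hzd t).continuousAt).continuousOn
    (a := 0) (b := τ₁) (f := z) (g := id)
    (fun t ht ↦ by
      have := (hzd t).hasDerivWithinAt (s := Ici t)
      rwa [← hzy t ⟨ht.1, ht.2.le⟩] at this)
    continuousOn_id
    (fun t ht ↦ by
      have := (hasDerivAt_id t).hasDerivWithinAt (s := Ici t)
      simpa [hg0 t ht.2.le] using this)
    (by simp [hz])
  rw [← hzy t ht]
  exact h ht

theorem one_le_speed {q : ℝ} (hq : q ∈ Icc 0 2) (hgb : ∀ x, g x ∈ Icc 0 4) (x : ℝ) :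
    1 ≤ 1 + q * g x := by nlinarith [mul_nonneg hq.1 (hgb x).1]

theorem speed_le_nine {q : ℝ} (hq : q ∈ Icc 0 2) (hgb : ∀ x, g x ∈ Icc 0 4) (x : ℝ) :
    1 + q * g x ≤ 9 := by
  nlinarith [mul_le_mul hq.2 (hgb x).2 (hgb x).1 (by norm_num : (0 : ℝ) ≤ 2)]

/-- Solutions of `y' = 1 + q g(y)` on `[τ₁, T]` started in `τ₁` with terminal value `x`. -/
def IsTerminalValue (g : ℝ → ℝ) (τ₁ T q x : ℝ) : Prop :=
  q ∈ Icc 0 2 ∧ ∃ y : ℝ → ℝ, Continuous y ∧ y T = x ∧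
    ∀ t ∈ Icc τ₁ T, y t = τ₁ + ∫ s in τ₁..t, (1 + q * g (y s))

theorem IsTerminalValue.mem_Icc (hτ₁ : τ₁ ≤ T) (hgc : Continuous g) (hgb : ∀ x, g x ∈ Icc 0 4)
    {q x : ℝ} (h : IsTerminalValue g τ₁ T q x) : x ∈ Icc T (τ₁ + 9 * (T - τ₁)) := by
  obtain ⟨hq, y, hy, rfl, heq⟩ := h
  have hc : Continuous fun s ↦ 1 + q * g (y s) := by fun_prop
  rw [heq T (right_mem_Icc.2 hτ₁)]
  have h1 := intervalIntegral.integral_mono_on hτ₁ (intervalIntegrable_const (μ := volume) (c := (1 : ℝ)))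
    (hc.intervalIntegrable _ _) fun s _ ↦ one_le_speed hq hgb (y s)
  have h2 := intervalIntegral.integral_mono_on hτ₁ (hc.intervalIntegrable _ _)
    (intervalIntegrable_const (μ := volume) (c := (9 : ℝ))) fun s _ ↦ speed_le_nine hq hgb (y s)
  rw [intervalIntegral.integral_const, smul_eq_mul] at h1 h2
  constructor <;> linarith

/-- Separation of variables. -/
theorem IsTerminalValue.integral_inv_eq (hτ₁ : τ₁ ≤ T) (hgc : Continuous g)
    (hgb : ∀ x, g x ∈ Icc 0 4) {q x : ℝ} (h : IsTerminalValue g τ₁ T q x) :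
    ∫ z in τ₁..x, (1 + q * g z)⁻¹ = T - τ₁ := by
  obtain ⟨hq, y, hy, rfl, heq⟩ := h
  have hc : Continuous fun s ↦ 1 + q * g (y s) := by fun_prop
  have hinv : Continuous fun z ↦ (1 + q * g z)⁻¹ :=
    Continuous.inv₀ (by fun_prop) fun z ↦ by linarith [one_le_speed hq hgb z]
  set w : ℝ → ℝ := fun t ↦ τ₁ + ∫ s in τ₁..t, (1 + q * g (y s)) with hw
  have hwd : ∀ t, HasDerivAt w (1 + q * g (y t)) t := fun t ↦
    (hasDerivAt_integral_of_continuous hc τ₁ t).const_add _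
  have h := intervalIntegral.integral_comp_mul_deriv (a := τ₁) (b := T) (fun t _ ↦ hwd t)
    hc.continuousOn hinv
  have h0 : w τ₁ = τ₁ := by simp [hw]
  have h1 : w T = y T := (heq T (right_mem_Icc.2 hτ₁)).symm
  rw [h0, h1] at h
  rw [← h]
  have hcongr : EqOn (fun t ↦ ((fun z ↦ (1 + q * g z)⁻¹) ∘ w) t * (1 + q * g (y t)))
      (fun _ ↦ (1 : ℝ)) (uIcc τ₁ T) := fun t ht ↦ by
    rw [uIcc_of_le hτ₁] at ht
    have : w t = y t := (heq t ht).symm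
    simp only [Function.comp_apply, this]
    exact inv_mul_cancel₀ (by linarith [one_le_speed hq hgb (y t)])
  rw [intervalIntegral.integral_congr hcongr]
  simp

/-- Both motions take the time `T - τ₁`, so the integral of `(1 + q₂ g)⁻¹` over `[x₁, x₂]` equals
the time saved by the faster motion on `[τ₁, x₁]`. This stretch contains `[τ₂, T]`, where `g = 4`
and speeds are at most `1 + 2 * 4 = 9`; hence the saving is at least `4 (q₂ - q₁) / 81` per unit
length. As speeds are at least `1`, the time spent on `[x₁, x₂]` is at most `x₂ - x₁`. -/
theorem IsTerminalValue.sub_le (hτ₁₂ : τ₁ ≤ τ₂) (hτ₂ : τ₂ ≤ T) (hgc : Continuous g)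
    (hgb : ∀ x, g x ∈ Icc 0 4) (hg4 : ∀ x, τ₂ ≤ x → g x = 4) {q₁ q₂ x₁ x₂ : ℝ} (hq : q₁ ≤ q₂)
    (h₁ : IsTerminalValue g τ₁ T q₁ x₁) (h₂ : IsTerminalValue g τ₁ T q₂ x₂) :
    4 / 81 * (T - τ₂) * (q₂ - q₁) ≤ x₂ - x₁ := by
  have hτ₁ := hτ₁₂.trans hτ₂
  have hpos : ∀ {q}, q ∈ Icc 0 2 → ∀ z, 0 < 1 + q * g z := fun hq z ↦ by
    linarith [one_le_speed hq hgb z]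
  have hinv : ∀ {q}, q ∈ Icc 0 2 → Continuous fun z ↦ (1 + q * g z)⁻¹ := fun hq ↦
    Continuous.inv₀ (by fun_prop) fun z ↦ (hpos hq z).ne'
  have hii : ∀ {q}, q ∈ Icc 0 2 → ∀ a b, IntervalIntegrable (fun z ↦ (1 + q * g z)⁻¹) volume a b :=
    fun hq a b ↦ (hinv hq).intervalIntegrable a b
  have hx₁ := h₁.mem_Icc hτ₁ hgc hgb
  have e₁ := h₁.integral_inv_eq hτ₁ hgc hgb
  have e₂ := h₂.integral_inv_eq hτ₁ hgc hgb
  rw [← intervalIntegral.integral_add_adjacent_intervals (hii h₂.1 τ₁ x₁) (hii h₂.1 x₁ x₂)] at e₂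
  have hd : Continuous fun z ↦ (1 + q₁ * g z)⁻¹ - (1 + q₂ * g z)⁻¹ := (hinv h₁.1).sub (hinv h₂.1)
  have hform : ∀ z, (1 + q₁ * g z)⁻¹ - (1 + q₂ * g z)⁻¹ =
      (q₂ - q₁) * g z / ((1 + q₁ * g z) * (1 + q₂ * g z)) := fun z ↦ by
    rw [inv_sub_inv (hpos h₁.1 z).ne' (hpos h₂.1 z).ne']
    ring
  have hnn : ∀ z, 0 ≤ (1 + q₁ * g z)⁻¹ - (1 + q₂ * g z)⁻¹ := fun z ↦ by
    rw [hform]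
    exact div_nonneg (mul_nonneg (sub_nonneg.2 hq) (hgb z).1)
      (mul_pos (hpos h₁.1 z) (hpos h₂.1 z)).le
  have hlow : ∀ z, τ₂ ≤ z → 4 / 81 * (q₂ - q₁) ≤ (1 + q₁ * g z)⁻¹ - (1 + q₂ * g z)⁻¹ :=
    fun z hz ↦ by
      have hp := mul_pos (hpos h₁.1 z) (hpos h₂.1 z)
      have hle : (1 + q₁ * g z) * (1 + q₂ * g z) ≤ 9 * 9 :=
        mul_le_mul (speed_le_nine h₁.1 hgb z) (speed_le_nine h₂.1 hgb z) (hpos h₂.1 z).le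
          (by norm_num)
      rw [hform, le_div_iff₀ hp, hg4 z hz] at *
      nlinarith [sub_nonneg.2 hq]
  have hI : 4 / 81 * (T - τ₂) * (q₂ - q₁) ≤
      ∫ z in τ₁..x₁, ((1 + q₁ * g z)⁻¹ - (1 + q₂ * g z)⁻¹) := by
    have hs1 := intervalIntegral.integral_mono_on (hτ₂.trans hx₁.1)
      (intervalIntegrable_const (μ := volume) (c := 4 / 81 * (q₂ - q₁))) (hd.intervalIntegrable τ₂ x₁)
      fun z hz ↦ hlow z hz.1
    have hs2 := intervalIntegral.integral_nonneg (μ := volume) hτ₁₂ fun z _ ↦ hnn z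
    have hs3 := intervalIntegral.integral_add_adjacent_intervals (μ := volume)
      (hd.intervalIntegrable τ₁ τ₂) (hd.intervalIntegrable τ₂ x₁)
    rw [intervalIntegral.integral_const, smul_eq_mul] at hs1
    have : 0 ≤ (x₁ - T) * (4 / 81 * (q₂ - q₁)) :=
      mul_nonneg (sub_nonneg.2 hx₁.1) (mul_nonneg (by norm_num) (sub_nonneg.2 hq))
    nlinarith
  rw [intervalIntegral.integral_sub (hii h₁.1 _ _) (hii h₂.1 _ _)] at hI
  have hI2 : 4 / 81 * (T - τ₂) * (q₂ - q₁) ≤ ∫ z in x₁..x₂, (1 + q₂ * g z)⁻¹ := by linarith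
  have hI0 : 0 ≤ 4 / 81 * (T - τ₂) * (q₂ - q₁) :=
    mul_nonneg (mul_nonneg (by norm_num) (sub_nonneg.2 hτ₂)) (sub_nonneg.2 hq)
  rcases le_or_gt x₁ x₂ with hx | hx
  · refine hI2.trans ?_
    have := intervalIntegral.integral_mono_on hx (hii h₂.1 x₁ x₂)
      (intervalIntegrable_const (μ := volume) (c := (1 : ℝ)))
      fun z _ ↦ inv_le_one_of_one_le₀ (one_le_speed h₂.1 hgb z)
    simpa using this
  · exfalso
    rw [intervalIntegral.integral_symm] at hI2
    have := intervalIntegral.intervalIntegral_pos_of_pos (hii h₂.1 x₂ x₁)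
      (fun z ↦ inv_pos.2 (hpos h₂.1 z)) hx
    linarith

/-- The terminal value of the second component is a function of the speed `q` on `[τ₁, T]` which
grows at least linearly. -/
theorem exists_terminal_function (hτ₁₂ : τ₁ ≤ τ₂) (hτ₂ : τ₂ ≤ T) (hgc : Continuous g)
    (hgb : ∀ x, g x ∈ Icc 0 4) (hg4 : ∀ x, τ₂ ≤ x → g x = 4) :
    ∃ F : ℝ → ℝ, Monotone (fun q ↦ F q - 4 / 81 * (T - τ₂) * q) ∧
      ∀ q x, IsTerminalValue g τ₁ T q x → x = F q := by
  classical
  set κ := 4 / 81 * (T - τ₂)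
  have hsub := fun {q₁ q₂ x₁ x₂ : ℝ} ↦
    IsTerminalValue.sub_le (q₁ := q₁) (q₂ := q₂) (x₁ := x₁) (x₂ := x₂) hτ₁₂ hτ₂ hgc hgb hg4
  have hκ : 0 ≤ κ := mul_nonneg (by norm_num) (sub_nonneg.2 hτ₂)
  have huniq : ∀ {q x x'}, IsTerminalValue g τ₁ T q x → IsTerminalValue g τ₁ T q x' → x = x' :=
    fun h h' ↦ by
      have h1 := hsub le_rfl h h'
      have h2 := hsub le_rfl h' h
      rw [sub_self, mul_zero] at h1 h2
      linarith
  -- Existence of solutions for every `q` is not needed: the function is defined on the set of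
  -- attained speeds, and its bounded monotone part is extended to the whole line. Monotonicity
  -- later supplies measurability.
  let A : Set ℝ := {q | ∃ x, IsTerminalValue g τ₁ T q x}
  let F₀ : ℝ → ℝ := fun q ↦ if h : ∃ x, IsTerminalValue g τ₁ T q x then h.choose else 0
  have hF₀ : ∀ q ∈ A, IsTerminalValue g τ₁ T q (F₀ q) := fun q hq ↦ by
    have hq' : ∃ x, IsTerminalValue g τ₁ T q x := hq
    simp only [F₀, dif_pos hq']
    exact hq'.choose_spec
  have hmono : MonotoneOn (fun q ↦ F₀ q - κ * q) A := fun q₁ h₁ q₂ h₂ hq ↦ by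
    have : κ * (q₂ - q₁) ≤ _ := hsub hq (hF₀ _ h₁) (hF₀ _ h₂)
    simp only
    linarith
  have hbdd : ∀ q ∈ A, F₀ q - κ * q ∈ Icc (T - κ * 2) (τ₁ + 9 * (T - τ₁)) := fun q hq ↦ by
    have h1 := (hF₀ q hq).mem_Icc (hτ₁₂.trans hτ₂) hgc hgb
    have h2 := (hF₀ q hq).1
    constructor
    · nlinarith [mul_le_mul_of_nonneg_left h2.2 hκ, h1.1]
    · nlinarith [mul_nonneg hκ h2.1, h1.2]
  obtain ⟨G, hG, hGeq⟩ := hmono.exists_monotone_extension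
    ⟨T - κ * 2, by rintro _ ⟨q, hq, rfl⟩; exact (hbdd q hq).1⟩
    ⟨τ₁ + 9 * (T - τ₁), by rintro _ ⟨q, hq, rfl⟩; exact (hbdd q hq).2⟩
  refine ⟨fun q ↦ G q + κ * q, by simpa using hG, fun q x hx ↦ ?_⟩
  have hq : q ∈ A := ⟨x, hx⟩
  have h := hGeq hq
  simp only at h ⊢
  rw [← h, huniq hx (hF₀ q hq)]
  ring

/-- A path of the second component with constant random speed after `τ₁` has a terminal value. -/
theorem isTerminalValue_of_eq (h0 : 0 ≤ τ₁) (hτ₁ : τ₁ ≤ T) {K : ℝ≥0} (hgL : LipschitzWith K g)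
    (hg0 : ∀ x ≤ τ₁, g x = 0) {y q : ℝ → ℝ} (hy : Continuous y) (hq : Continuous q)
    (hq2 : ∀ t, q t ∈ Icc 0 2)
    (heq : ∀ t ∈ Icc 0 T, y t = t + ∫ s in (0 : ℝ)..t, g (y s) * q s) {q₀ : ℝ}
    (hconst : ∀ t ∈ Icc τ₁ T, q t = q₀) : IsTerminalValue g τ₁ T q₀ (y T) := by
  have hc : Continuous fun s ↦ g (y s) * q s := (hgL.continuous.comp hy).mul hq
  refine ⟨hconst T (right_mem_Icc.2 hτ₁) ▸ hq2 T, y, hy, rfl, fun t ht ↦ ?_⟩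
  have h1 := eq_id_of_le hτ₁ hgL hg0 hy hq hq2 heq (right_mem_Icc.2 h0)
  rw [heq τ₁ ⟨h0, hτ₁⟩] at h1
  rw [heq t ⟨h0.trans ht.1, ht.2⟩, ← intervalIntegral.integral_add_adjacent_intervals
    (hc.intervalIntegrable 0 τ₁) (hc.intervalIntegrable τ₁ t)]
  have h2 : ∫ s in τ₁..t, (1 + q₀ * g (y s)) = ∫ s in τ₁..t, (1 + g (y s) * q s) := by
    refine intervalIntegral.integral_congr fun s hs ↦ ?_
    rw [uIcc_of_le ht.1] at hs
    simp only [hconst s ⟨hs.1, hs.2.trans ht.2⟩]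
    ring
  rw [h2, intervalIntegral.integral_add (by simp) (hc.intervalIntegrable _ _),
    intervalIntegral.integral_const]
  simp only [smul_eq_mul, mul_one]
  linarith

end Ode

/-! ### Splitting the Wiener integral over a gap: Brownian bridge and variance bounds. -/

section Gap

variable {Ω : Type*} {m : MeasurableSpace Ω} {T : ℝ}

section Bridge

variable {𝓕 : Filtration (Icc (0 : ℝ) T) m} {P : Measure Ω} {W : Icc (0 : ℝ) T → Ω → ℝ}

/-- The σ-algebra generated by the values of `W` on `S`. -/
@[reducible] def pathSigma (W : Icc (0 : ℝ) T → Ω → ℝ) (S : Set ℝ) (hS : S ⊆ Icc 0 T) : MeasurableSpace Ω :=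
  MeasurableSpace.comap (fun ω (s : S) ↦ W ⟨s, hS s.2⟩ ω) MeasurableSpace.pi

theorem measurable_pathSigma {S : Set ℝ} (hS : S ⊆ Icc 0 T) {s : Icc (0 : ℝ) T}
    (hs : (s : ℝ) ∈ S) : Measurable[pathSigma W S hS] (W s) :=
  (measurable_pi_apply (⟨s, hs⟩ : S)).comp
    (comap_measurable fun ω (s : S) ↦ W ⟨s, hS s.2⟩ ω)

theorem pathSigma_le (hW : ∀ t, Measurable (W t)) {S : Set ℝ} (hS : S ⊆ Icc 0 T) :
    pathSigma W S hS ≤ m :=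
  measurable_iff_comap_le.1 (measurable_pi_lambda _ fun _ ↦ hW _)

/-- The interpolation weight of `s` between `a` and `b`. -/
def weight (a b s : ℝ) : ℝ := (s - a) / (b - a)

/-- The Brownian bridge obtained from `W` on `[a, b]` by subtracting the linear interpolation. -/
def bridge (W : Icc (0 : ℝ) T → Ω → ℝ) (a b s : Icc (0 : ℝ) T) (ω : Ω) : ℝ :=
  W s ω - (1 - weight a b s) * W a ω - weight a b s * W b ω

/-- The two families are jointly Gaussian, so zero covariance suffices. It holds because `s ↦ min s
u` is affine on `[a, b]` when `u` lies outside `(a, b)`, and the bridge subtracts the affine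
interpolation. -/
theorem IsStandardBrownianMotion.indepFun_bridge [IsProbabilityMeasure P] (hT : 0 ≤ T)
    (hW : IsStandardBrownianMotion 𝓕 P W) {a b : Icc (0 : ℝ) T} (hab : a < b)
    (hS : Icc 0 (a : ℝ) ∪ Icc (b : ℝ) T ⊆ Icc 0 T) :
    IndepFun (fun ω (s : Icc a b) ↦ bridge W a b s ω)
      (fun ω (s : ↥(Icc 0 (a : ℝ) ∪ Icc (b : ℝ) T)) ↦ W ⟨s, hS s.2⟩ ω) P := by
  classical
  have hbm : ∀ s, Measurable (bridge W a b s) := fun s ↦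
    ((hW.measurable s).sub ((hW.measurable a).const_mul _)).sub ((hW.measurable b).const_mul _)
  have h2 : ∀ t, MemLp (W t) 2 P := fun t ↦ hW.memLp hT t 2 (by simp)
  refine IsGaussianProcess.indepFun_of_covariance_eq_zero
    (X := fun (s : Icc a b) ↦ bridge W a b s)
    (Y := fun (s : ↥(Icc 0 (a : ℝ) ∪ Icc (b : ℝ) T)) ↦ W ⟨s, hS s.2⟩) ?_
    (fun s ↦ (hbm s).aemeasurable) (fun s ↦ (hW.measurable _).aemeasurable) fun s u ↦ ?_
  · refine IsGaussianProcess.of_isGaussianProcess (hW.isGaussianProcess hT) ?_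
    rintro (s | u)
    · refine ⟨{(s : Icc (0 : ℝ) T), a, b},
        { toFun x := x ⟨s, by simp⟩ - (1 - weight a b s) * x ⟨a, by simp⟩ -
            weight a b s * x ⟨b, by simp⟩
          map_add' x y := by simp; ring
          map_smul' c x := by simp; ring }, fun ω ↦ ?_⟩
      simp [bridge]
    · refine ⟨{⟨u, hS u.2⟩},
        { toFun x := x ⟨⟨u, hS u.2⟩, by simp⟩
          map_add' x y := by simp
          map_smul' c x := by simp }, fun ω ↦ ?_⟩
      simp
  · have hcov : cov[bridge W a b s, W ⟨u, hS u.2⟩; P] = min (s : ℝ) u -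
        (1 - weight a b s) * min (a : ℝ) u - weight a b s * min (b : ℝ) u := by
      have hsplit : bridge W a b s = W s - (fun ω ↦ (1 - weight a b s) * W a ω) -
        fun ω ↦ weight a b s * W b ω := rfl
      rw [hsplit, covariance_sub_left ((h2 s).sub ((h2 a).const_mul _)) ((h2 b).const_mul _) (h2 _),
        covariance_sub_left (h2 s) ((h2 a).const_mul _) (h2 _), covariance_const_mul_left,
        covariance_const_mul_left, hW.covariance_eq hT, hW.covariance_eq hT, hW.covariance_eq hT]
    rw [hcov]
    have hab' : (a : ℝ) < b := hab
    have hsa : (a : ℝ) ≤ s := s.2.1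
    have hsb : (s : ℝ) ≤ b := s.2.2
    rcases u.2 with hu | hu
    · rw [min_eq_right (hu.2.trans hsa), min_eq_right hu.2, min_eq_right (hu.2.trans hab'.le)]
      ring
    · rw [min_eq_left (hsb.trans hu.1), min_eq_left (hab'.le.trans hu.1), min_eq_left hu.1, weight]
      have : (b : ℝ) - a ≠ 0 := (sub_pos.2 hab').ne'
      field_simp
      ring

/-- The σ-algebra is arbitrary so that the same statement serves the known part of the path and the
coordinate process on path space. -/
theorem measurable_wienerIntegral (hT : 0 ≤ T) (hW : ∀ ω, Continuous fun t ↦ W t ω)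
    (m' : MeasurableSpace Ω) {φ : ℝ → ℝ} (hφ : ContDiff ℝ 1 φ) {c d : ℝ} (hcd : c ≤ d)
    (hm : ∀ s ∈ Icc c d, Measurable[m'] (W (projIcc 0 T hT s))) :
    Measurable[m'] (wienerIntegral hT W φ c d) :=
  measurable_of_tendsto_metrizable (fun k ↦ Finset.measurable_sum _ fun i hi ↦
    ((hm _ (node_mem hcd (Finset.mem_range.1 hi : i + 1 ≤ k + 1))).sub
      (hm _ (node_mem hcd (Finset.mem_range.1 hi).le))).const_mul _)
    (tendsto_pi_nhds.2 fun ω ↦ tendsto_wienerIntegral hT hW hφ hcd ω)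

theorem projIcc_mem_Icc (hT : 0 ≤ T) {a b : Icc (0 : ℝ) T} {s : ℝ} (hs : s ∈ Icc (a : ℝ) b) :
    projIcc 0 T hT s ∈ Icc a b := by
  rw [projIcc_of_mem hT ⟨a.2.1.trans hs.1, hs.2.trans b.2.2⟩]
  exact hs

/-- The Wiener integral over `[a, b]` of a function with mean zero is a functional of the Brownian
bridge on `[a, b]`, hence independent of `W` outside `[a, b]`. -/
theorem IsStandardBrownianMotion.indep_wienerIntegral [IsProbabilityMeasure P] (hT : 0 ≤ T)
    (hW : IsStandardBrownianMotion 𝓕 P W) {a b : Icc (0 : ℝ) T} (hab : a < b)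
    (hS : Icc 0 (a : ℝ) ∪ Icc (b : ℝ) T ⊆ Icc 0 T) {φ : ℝ → ℝ} (hφ : ContDiff ℝ 1 φ)
    (hφ0 : ∫ s in (a : ℝ)..b, φ s = 0) :
    Indep (MeasurableSpace.comap (wienerIntegral hT W φ a b) inferInstance)
      (pathSigma W (Icc 0 (a : ℝ) ∪ Icc (b : ℝ) T) hS) P := by
  have hab' : (a : ℝ) < b := hab
  have hind := hW.indepFun_bridge hT hab hS
  rw [IndepFun_iff_Indep] at hind
  refine indep_of_indep_of_le_left hind (measurable_iff_comap_le.1 ?_)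
  set m' : MeasurableSpace Ω :=
    MeasurableSpace.comap (fun ω (s : Icc a b) ↦ bridge W a b s ω) MeasurableSpace.pi with hm'
  have hbm : ∀ s ∈ Icc a b, Measurable[m'] (bridge W a b s) := fun s hs ↦
    (measurable_pi_apply (⟨s, hs⟩ : Icc a b)).comp
      (comap_measurable fun ω (s : Icc a b) ↦ bridge W a b s ω)
  refine measurable_of_tendsto_metrizable (f := fun k ω ↦ ∑ i ∈ Finset.range (k + 1),
    φ (node a b k i) * (bridge W a b (projIcc 0 T hT (node a b k (i + 1))) ω -
      bridge W a b (projIcc 0 T hT (node a b k i)) ω)) (fun k ↦ ?_)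
    (tendsto_pi_nhds.2 fun ω ↦ ?_)
  · refine Finset.measurable_sum _ fun i hi ↦ Measurable.const_mul (Measurable.sub ?_ ?_) _
    · exact hbm _ (projIcc_mem_Icc hT
        (node_mem hab'.le (Finset.mem_range.1 hi : i + 1 ≤ k + 1)))
    · exact hbm _ (projIcc_mem_Icc hT (node_mem hab'.le (Finset.mem_range.1 hi).le))
  · have h1 := tendsto_wienerIntegral hT hW.continuous_path hφ hab'.le ω
    -- Replacing `W` by the bridge changes the Stieltjes sums by the slope of the interpolation
    -- times the Riemann sums of `φ`, which tend to zero since `φ` has mean zero.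
    have h2 := (tendsto_riemann_sum hab'.le hφ.continuous).const_mul
      ((W b ω - W a ω) / ((b : ℝ) - a))
    rw [hφ0, mul_zero] at h2
    have h3 := h1.sub h2
    rw [sub_zero] at h3
    refine h3.congr fun k ↦ ?_
    rw [Finset.mul_sum, ← Finset.sum_sub_distrib]
    refine Finset.sum_congr rfl fun i hi ↦ ?_
    have hn1 := node_mem hab'.le (Finset.mem_range.1 hi : i + 1 ≤ k + 1)
    have hn2 := node_mem hab'.le (Finset.mem_range.1 hi).le
    have e1 := projIcc_of_mem hT
      (⟨a.2.1.trans hn1.1, hn1.2.trans b.2.2⟩ : node a b k (i + 1) ∈ Icc 0 T)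
    have e2 := projIcc_of_mem hT ⟨a.2.1.trans hn2.1, hn2.2.trans b.2.2⟩
    simp only [bridge, weight, e1, e2]
    have : (b : ℝ) - a ≠ 0 := (sub_pos.2 hab').ne'
    field_simp
    ring

theorem wienerIntegral_add_adjacent (hT : 0 ≤ T) (hW : ∀ ω, Continuous fun t ↦ W t ω)
    {φ : ℝ → ℝ} (hφ : ContDiff ℝ 1 φ) (c d e : ℝ) (ω : Ω) :
    wienerIntegral hT W φ c d ω + wienerIntegral hT W φ d e ω = wienerIntegral hT W φ c e ω := by
  have hint : ∀ x y, IntervalIntegrable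
      (fun s ↦ deriv φ s * W (projIcc 0 T hT s) ω) volume x y := fun x y ↦
    ((hφ.continuous_deriv le_rfl).mul ((hW ω).comp continuous_projIcc)).intervalIntegrable x y
  simp only [wienerIntegral]
  rw [← intervalIntegral.integral_add_adjacent_intervals (hint c d) (hint d e)]
  ring

theorem wienerIntegral_sub_const (hT : 0 ≤ T) (φ : ℝ → ℝ) (r c d : ℝ) (ω : Ω) :
    wienerIntegral hT W (fun s ↦ φ s - r) c d ω = wienerIntegral hT W φ c d ω -
      r * (W (projIcc 0 T hT d) ω - W (projIcc 0 T hT c) ω) := by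
  have : deriv (fun s ↦ φ s - r) = deriv φ := by
    ext s
    exact deriv_sub_const r
  simp only [wienerIntegral, this]
  ring

/-- If `U` and `V` are independent, `V` and `U + V` are centred Gaussian, then so is `U`. -/
theorem hasLaw_gaussianReal_of_add [IsProbabilityMeasure P] {U V : Ω → ℝ} (hU : Measurable U)
    (hV : Measurable V) (hind : U ⟂ᵢ[P] V) {v α : ℝ≥0} (hv : v ≤ α)
    (hVlaw : P.map V = gaussianReal 0 v) (hlaw : P.map (U + V) = gaussianReal 0 α) :
    P.map U = gaussianReal 0 (α - v) := by
  have := Measure.isProbabilityMeasure_map (μ := P) hU.aemeasurable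
  refine Measure.ext_of_charFun (funext fun x ↦ ?_)
  have h := congrFun (hind.charFun_map_add_eq_mul hU.aemeasurable hV.aemeasurable) x
  rw [hlaw, Pi.mul_apply, hVlaw, charFun_gaussianReal, charFun_gaussianReal] at h
  rw [charFun_gaussianReal]
  refine mul_right_cancel₀ (Complex.exp_ne_zero (x * (0 : ℝ) * Complex.I - v * x ^ 2 / 2)) ?_
  rw [← h, ← Complex.exp_add]
  congr 1
  rw [NNReal.coe_sub hv]
  push_cast
  ring

end Bridge

section Variance

/-- The mean value of `f` over `[a, b]`. -/
def mean (f : ℝ → ℝ) (a b : ℝ) : ℝ := (∫ s in a..b, f s) / (b - a)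

variable {f : ℝ → ℝ} {a b : ℝ}

theorem integral_sub_mean (hf : Continuous f) (hab : a < b) :
    ∫ s in a..b, (f s - mean f a b) = 0 := by
  rw [intervalIntegral.integral_sub (hf.intervalIntegrable _ _) (by simp),
    intervalIntegral.integral_const, smul_eq_mul, mean, mul_div_cancel₀ _ (sub_pos.2 hab).ne',
    sub_self]

theorem integral_sub_midpoint_sq : ∫ s in a..b, (s - (a + b) / 2) ^ 2 = (b - a) ^ 3 / 12 := by
  rw [intervalIntegral.integral_comp_sub_right (fun x ↦ x ^ 2), integral_pow]
  push_cast
  ring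

theorem integral_sub_midpoint : ∫ s in a..b, (s - (a + b) / 2) = 0 := by
  rw [intervalIntegral.integral_comp_sub_right (fun x ↦ x), integral_id]
  ring

/-- The mean is the best constant approximation in mean square, so it may be replaced by the
midpoint value; then `4 * (b - a) ^ 3 / 12` is left. -/
theorem integral_sub_mean_sq_le (hf : Continuous f) (hab : a < b)
    (hupper : ∀ s ∈ Icc a b, |f s - f ((a + b) / 2)| ≤ 2 * |s - (a + b) / 2|) :
    ∫ s in a..b, (f s - mean f a b) ^ 2 ≤ (b - a) ^ 3 / 3 := by
  set c := f ((a + b) / 2)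
  set r := mean f a b
  have h1 : ∫ s in a..b, (f s - r) ^ 2 ≤ ∫ s in a..b, (f s - c) ^ 2 := by
    have h0 := integral_sub_mean hf hab
    have hsplit : ∀ s, (f s - c) ^ 2 = (f s - r) ^ 2 + (2 * (r - c) * (f s - r) + (r - c) ^ 2) :=
      fun s ↦ by ring
    simp_rw [hsplit]
    rw [intervalIntegral.integral_add (Continuous.intervalIntegrable (by fun_prop) _ _)
      (Continuous.intervalIntegrable (by fun_prop) _ _),
      intervalIntegral.integral_add (Continuous.intervalIntegrable (by fun_prop) _ _) (by simp),
      intervalIntegral.integral_const_mul, h0, intervalIntegral.integral_const, smul_eq_mul]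
    nlinarith [mul_nonneg (sub_pos.2 hab).le (sq_nonneg (r - c))]
  refine h1.trans ?_
  have h2 : ∫ s in a..b, (f s - c) ^ 2 ≤ ∫ s in a..b, 4 * (s - (a + b) / 2) ^ 2 := by
    refine intervalIntegral.integral_mono_on hab.le
      (Continuous.intervalIntegrable (by fun_prop) _ _)
      (Continuous.intervalIntegrable (by fun_prop) _ _) fun s hs ↦ ?_
    have := pow_le_pow_left₀ (abs_nonneg _) (hupper s hs) 2
    rw [mul_pow, sq_abs, sq_abs] at this
    linarith
  rw [intervalIntegral.integral_const_mul, integral_sub_midpoint_sq] at h2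
  linarith

theorem le_integral_sub_mean_sq (hf : Continuous f) (hab : a < b)
    (hlower : ∀ s ∈ Icc a b, (s - (a + b) / 2) ^ 2 ≤
      -((f s - f ((a + b) / 2)) * (s - (a + b) / 2))) :
    (b - a) ^ 3 / 12 ≤ ∫ s in a..b, (f s - mean f a b) ^ 2 := by
  set c := f ((a + b) / 2)
  set r := mean f a b
  have h := intervalIntegral.integral_mono_on (μ := volume) hab.le
    (f := fun s ↦ (s - (a + b) / 2) ^ 2 + 2 * (r - c) * (s - (a + b) / 2))
    (g := fun s ↦ (f s - r) ^ 2)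
    (Continuous.intervalIntegrable (by fun_prop) _ _)
    (Continuous.intervalIntegrable (by fun_prop) _ _) fun s hs ↦ by
      -- The optimal comparison for slope `-1`: the square of `f - r` is bounded below by its
      -- tangent at `-(s - (a + b) / 2)`, and the resulting linear term integrates to zero.
      nlinarith [hlower s hs, sq_nonneg (f s - r + (s - (a + b) / 2))]
  rw [intervalIntegral.integral_add (Continuous.intervalIntegrable (by fun_prop) _ _)
    (Continuous.intervalIntegrable (by fun_prop) _ _), intervalIntegral.integral_const_mul,
    integral_sub_midpoint, integral_sub_midpoint_sq] at h
  linarith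

theorem variance_bounds {τ : ℝ} (hf : ContDiff ℝ 1 f) (hf' : deriv f '' Ioo 0 τ ⊆ Ico (-2) (-1))
    (ha : 0 ≤ a) (hab : a < b) (hb : b ≤ τ) :
    ∫ s in a..b, (f s - mean f a b) ^ 2 ∈ Icc ((b - a) ^ 3 / 12) ((b - a) ^ 3 / 3) := by
  have hd : Differentiable ℝ f := hf.differentiable (by simp)
  have hderiv : ∀ s ∈ Ioo 0 τ, deriv f s ∈ Ico (-2) (-1) := fun s hs ↦
    hf' (mem_image_of_mem _ hs)
  have hmono : MonotoneOn (fun s ↦ f s + 2 * s) (Icc 0 τ) := by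
    refine monotoneOn_of_deriv_nonneg (convex_Icc _ _)
      (hd.continuous.add (by fun_prop)).continuousOn (by fun_prop) fun s hs ↦ ?_
    rw [interior_Icc] at hs
    rw [deriv_fun_add hd.differentiableAt (by fun_prop)]
    have := (hderiv s hs).1
    simp
    linarith
  have hanti : AntitoneOn (fun s ↦ f s + s) (Icc 0 τ) := by
    refine antitoneOn_of_deriv_nonpos (convex_Icc _ _)
      (hd.continuous.add (by fun_prop)).continuousOn (by fun_prop) fun s hs ↦ ?_
    rw [interior_Icc] at hs
    rw [deriv_fun_add hd.differentiableAt (by fun_prop)]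
    have := (hderiv s hs).2
    simp
    linarith
  have hmid : (a + b) / 2 ∈ Icc 0 τ := ⟨by linarith, by linarith⟩
  have hmem : ∀ s ∈ Icc a b, s ∈ Icc 0 τ := fun s hs ↦ ⟨ha.trans hs.1, hs.2.trans hb⟩
  refine ⟨le_integral_sub_mean_sq hf.continuous hab fun s hs ↦ ?_,
    integral_sub_mean_sq_le hf.continuous hab fun s hs ↦ ?_⟩
  · rcases le_total s ((a + b) / 2) with h | h
    · have := hanti (hmem s hs) hmid h
      simp only at this
      nlinarith
    · have := hanti hmid (hmem s hs) h
      simp only at this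
      nlinarith
  · rcases le_total s ((a + b) / 2) with h | h
    · have h1 := hanti (hmem s hs) hmid h
      have h2 := hmono (hmem s hs) hmid h
      simp only at h1 h2
      rw [abs_of_nonneg (by linarith), abs_of_nonpos (by linarith)]
      linarith
    · have h1 := hanti hmid (hmem s hs) h
      have h2 := hmono hmid (hmem s hs) h
      simp only at h1 h2
      rw [abs_of_nonpos (by linarith), abs_of_nonneg (by linarith)]
      linarith

end Variance

end Gap

/-! ### Measurability on path space, the smooth function `ψ`, and symmetrization. -/

section PathSpace

variable {Ω : Type*} {m : MeasurableSpace Ω} {T : ℝ}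

/-- The sample path is a Borel measurable map into the space of continuous functions. -/
theorem measurable_pathOn {W : Icc (0 : ℝ) T → Ω → ℝ} (hW : ∀ ω, Continuous fun t ↦ W t ω)
    {S : Set ℝ} (hS : S ⊆ Icc 0 T) (hSc : IsCompact S) :
    @Measurable _ _ (pathSigma W S hS) (borel C(S, ℝ)) (pathOn W hW S hS) := by
  have : CompactSpace S := isCompact_iff_compactSpace.1 hSc
  let _ : MeasurableSpace C(S, ℝ) := borel _
  have : BorelSpace C(S, ℝ) := ⟨rfl⟩
  obtain ⟨D, hDc, hDd⟩ := TopologicalSpace.exists_countable_dense S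
  -- Since `C(S, ℝ)` is separable and metrizable for compact `S`, open sets are countable unions of
  -- closed balls; a closed ball is described by the values at countably many times.
  have hball : ∀ (x : C(S, ℝ)) (r : ℝ), 0 ≤ r →
      MeasurableSet[pathSigma W S hS] (pathOn W hW S hS ⁻¹' Metric.closedBall x r) := fun x r hr ↦ by
    have hset : pathOn W hW S hS ⁻¹' Metric.closedBall x r =
        ⋂ s ∈ D, {ω | dist (W ⟨s, hS s.2⟩ ω) (x s) ≤ r} := by
      ext ω
      simp only [mem_preimage, Metric.mem_closedBall, mem_iInter, mem_ofPred_eq]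
      rw [ContinuousMap.dist_le hr]
      refine ⟨fun h s _ ↦ h s, fun h s ↦ ?_⟩
      have hcl : IsClosed {s : S | dist (pathOn W hW S hS ω s) (x s) ≤ r} :=
        isClosed_le (by fun_prop) continuous_const
      exact hcl.closure_subset_iff.2 (fun s hs ↦ h s hs) (hDd.closure_eq ▸ mem_univ s)
    rw [hset]
    refine MeasurableSet.biInter hDc fun s _ ↦ ?_
    have h1 : Measurable[pathSigma W S hS] (W ⟨s, hS s.2⟩) := measurable_pathSigma hS s.2
    have h2 : Continuous fun y : ℝ ↦ dist y (x s) := by fun_prop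
    exact (h2.measurable.comp h1) measurableSet_Iic
  refine @measurable_of_isOpen _ _ _ _ _ (pathSigma W S hS) _ fun O hO ↦ ?_
  obtain ⟨A, hAc, hAd⟩ := TopologicalSpace.exists_countable_dense C(S, ℝ)
  have hO' : O = ⋃ x ∈ A, ⋃ n : ℕ, ⋃ _ : Metric.closedBall x (1 / ((n : ℝ) + 1)) ⊆ O,
      Metric.closedBall x (1 / ((n : ℝ) + 1)) := by
    refine subset_antisymm (fun y hy ↦ ?_) (by simp)
    obtain ⟨ε, hε, hεO⟩ := Metric.isOpen_iff.1 hO y hy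
    obtain ⟨n, hn⟩ := exists_nat_one_div_lt (half_pos hε)
    obtain ⟨x, hxA, hx⟩ := hAd.exists_dist_lt y (Nat.one_div_pos_of_nat (α := ℝ) (n := n))
    simp only [mem_iUnion]
    refine ⟨x, hxA, n, fun z hz ↦ hεO ?_, Metric.mem_closedBall.2 hx.le⟩
    rw [Metric.mem_ball]
    rw [Metric.mem_closedBall] at hz
    rw [dist_comm] at hx
    linarith [dist_triangle z x y]
  rw [hO']
  simp only [preimage_iUnion]
  exact MeasurableSet.biUnion hAc fun x _ ↦ MeasurableSet.iUnion fun n ↦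
    MeasurableSet.iUnion fun _ ↦ hball x _ (by positivity)

/-- There is a smooth function which is linear with prescribed slopes on the intervals
`[2k, 2k + 1]`. -/
theorem exists_contDiff_piecewise_linear (l : ℕ → ℝ) :
    ∃ ψ : ℝ → ℝ, ContDiff ℝ (⊤ : ℕ∞) ψ ∧ ∀ k : ℕ, ∀ x ∈ Icc (2 * k : ℝ) (2 * k + 1),
      ψ x = l k * x := by
  let t : ℝ → Set ℝ := fun x ↦
    {y | ∀ k : ℕ, x ∈ Icc (2 * k : ℝ) (2 * k + 1) → y = l k * x}
  have hconv : ∀ x, Convex ℝ (t x) := by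
    intro x y hy z hz a b _ _ hab k hk
    rw [hy k hk, hz k hk, ← add_smul, hab, one_smul]
  have hloc : ∀ x : ℝ, ∃ U ∈ 𝓝 x, ∃ g : ℝ → ℝ, ContMDiffOn (modelWithCornersSelf ℝ ℝ)
      (modelWithCornersSelf ℝ ℝ) (⊤ : ℕ∞) g U ∧ ∀ y ∈ U, g y ∈ t y := by
    intro x
    -- The constraints are convex, so local solutions can be glued. An enlarged window meets no
    -- other window; a point outside all enlarged windows has a neighbourhood of radius `1 / 4` free
    -- of constraints.
    by_cases hx : ∃ k : ℕ, x ∈ Ioo (2 * k - 1 / 2 : ℝ) (2 * k + 3 / 2)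
    · obtain ⟨k, hk⟩ := hx
      refine ⟨_, Ioo_mem_nhds hk.1 hk.2, fun x ↦ l k * x,
        (contDiff_const.mul contDiff_id).contMDiff.contMDiffOn, fun y hy j hj ↦ ?_⟩
      have h1 : (2 * j : ℝ) < 2 * k + 3 / 2 := hj.1.trans_lt hy.2
      have h2 : (2 * k - 1 / 2 : ℝ) < 2 * j + 1 := hy.1.trans_le hj.2
      have h3 : (j : ℝ) < k + 1 := by linarith
      have h4 : (k : ℝ) < j + 1 := by linarith
      have h5 : j = k := by
        have h3' : j < k + 1 := by exact_mod_cast h3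
        have h4' : k < j + 1 := by exact_mod_cast h4
        omega
      rw [h5]
    · refine ⟨_, Ioo_mem_nhds (show x - 1 / 4 < x by linarith) (show x < x + 1 / 4 by linarith),
        fun _ ↦ 0, contMDiffOn_const, fun y hy j hj ↦ absurd ⟨j, ?_, ?_⟩ hx⟩
      · linarith [hy.1, hy.2, hj.1]
      · linarith [hy.1, hy.2, hj.2]
  obtain ⟨ψ, hψ⟩ := exists_contMDiffMap_forall_mem_convex_of_local (modelWithCornersSelf ℝ ℝ)
    hconv hloc
  exact ⟨ψ, ψ.contMDiff.contDiff, fun k x hx ↦ hψ x k hx⟩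

end PathSpace

/-- If `V` is symmetric and independent of `𝓢`, then `G (U + V)` and `G (U - V)` cannot be told
apart by an `𝓢`-measurable `Y`. -/
theorem lintegral_symmetrization_le {Ω : Type*} {𝓢 m : MeasurableSpace Ω} {P : Measure Ω}
    [IsProbabilityMeasure P] (h𝓢 : 𝓢 ≤ m) {U V Y : Ω → ℝ} (hV : Measurable V)
    (hind : Indep (MeasurableSpace.comap V inferInstance) 𝓢 P) (hU : Measurable[𝓢] U)
    (hY : Measurable[𝓢] Y) {v : ℝ≥0} (hlaw : P.map V = gaussianReal 0 v) {G : ℝ → ℝ}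
    (hG : Measurable G) :
    ∫⁻ ω, ‖G (U ω + V ω) - G (U ω - V ω)‖ₑ ∂P ≤ 2 * ∫⁻ ω, ‖G (U ω + V ω) - Y ω‖ₑ ∂P := by
  have hUm : Measurable U := hU.mono h𝓢 le_rfl
  have hYm : Measurable Y := hY.mono h𝓢 le_rfl
  have hR : Measurable fun ω ↦ (U ω, Y ω) := hUm.prodMk hYm
  have hRV : (fun ω ↦ (U ω, Y ω)) ⟂ᵢ[P] V := by
    rw [IndepFun_iff_Indep]
    exact indep_of_indep_of_le_left hind.symm (measurable_iff_comap_le.1 (hU.prodMk hY))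
  have hRV' : (fun ω ↦ (U ω, Y ω)) ⟂ᵢ[P] fun ω ↦ -V ω := hRV.comp measurable_id measurable_neg
  have hlaw' : P.map (fun ω ↦ -V ω) = gaussianReal 0 v := by
    have h : P.map (fun ω ↦ -V ω) = (P.map V).map fun x ↦ -x :=
      (Measure.map_map measurable_neg hV).symm
    rw [h, hlaw, gaussianReal_map_neg, neg_zero]
  -- By independence and symmetry, reflecting `V` does not change the joint law, so `Y` is equally
  -- far from both outcomes and the triangle inequality applies.
  have hjoint : P.map (fun ω ↦ ((U ω, Y ω), V ω)) = P.map fun ω ↦ ((U ω, Y ω), -V ω) := by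
    rw [(indepFun_iff_map_prod_eq_prod_map_map hR.aemeasurable hV.aemeasurable).1 hRV,
      (indepFun_iff_map_prod_eq_prod_map_map hR.aemeasurable
        (show AEMeasurable (fun ω ↦ -V ω) P from hV.neg.aemeasurable)).1 hRV',
      hlaw, hlaw']
  have hK : Measurable fun p : (ℝ × ℝ) × ℝ ↦ ‖G (p.1.1 + p.2) - p.1.2‖ₑ := by fun_prop
  have hsymm : ∫⁻ ω, ‖G (U ω + V ω) - Y ω‖ₑ ∂P = ∫⁻ ω, ‖G (U ω - V ω) - Y ω‖ₑ ∂P := by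
    have h1 := lintegral_map (μ := P) hK (hR.prodMk hV)
    have h2 := lintegral_map (μ := P) hK (hR.prodMk hV.neg)
    simp only [sub_eq_add_neg] at h1 h2 ⊢
    rw [← h1, hjoint]
    exact h2
  have htri : ∀ ω, ‖G (U ω + V ω) - G (U ω - V ω)‖ₑ ≤
      ‖G (U ω + V ω) - Y ω‖ₑ + ‖G (U ω - V ω) - Y ω‖ₑ := fun ω ↦ by
    have h : G (U ω + V ω) - G (U ω - V ω) =
        (G (U ω + V ω) - Y ω) - (G (U ω - V ω) - Y ω) := by ring
    rw [h]
    exact enorm_sub_le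
  refine (lintegral_mono htri).trans ?_
  rw [lintegral_add_left (by fun_prop), ← hsymm, two_mul]

/-! ### Lower bounds for the oscillation of `cos ∘ ψ`. -/

section Oscillation

variable {Ω : Type*} {m : MeasurableSpace Ω}

theorem le_integral_sin_sq {l c d : ℝ} (hl : 0 < l) :
    (d - c) / 2 - 1 / (2 * l) ≤ ∫ x in c..d, Real.sin (l * x) ^ 2 := by
  rw [intervalIntegral.integral_comp_mul_left (fun x ↦ Real.sin x ^ 2) hl.ne', integral_sin_sq,
    smul_eq_mul]
  have hsc : ∀ x, |Real.sin x * Real.cos x| ≤ 1 / 2 := fun x ↦ by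
    rw [abs_le]
    constructor <;> nlinarith [Real.sin_sq_add_cos_sq x, sq_nonneg (Real.sin x + Real.cos x),
      sq_nonneg (Real.sin x - Real.cos x)]
  have h1 := (abs_le.1 (hsc (l * c))).1
  have h2 := (abs_le.1 (hsc (l * d))).2
  have h3 : (d - c) / 2 - 1 / (2 * l) = l⁻¹ * ((l * d - l * c - 1) / 2) := by
    field_simp
  rw [h3]
  exact mul_le_mul_of_nonneg_left (by linarith) (inv_nonneg.2 hl.le)

theorem ofReal_le_lintegral_gaussianReal {v : ℝ≥0} (hv : v ≠ 0) {l c d p : ℝ} (hl : 0 < l)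
    (hcd : c ≤ d) (hp : 0 ≤ p) (hpdf : ∀ x ∈ Icc c d, p ≤ gaussianPDFReal 0 v x) :
    ENNReal.ofReal (p * ((d - c) / 2 - 1 / (2 * l))) ≤
      ∫⁻ x, (Icc c d).indicator (fun x ↦ ENNReal.ofReal (Real.sin (l * x) ^ 2)) x
        ∂gaussianReal 0 v := by
  rw [gaussianReal_of_var_ne_zero 0 hv,
    lintegral_withDensity_eq_lintegral_mul _ (measurable_gaussianPDF 0 v)
      (Measurable.indicator (by fun_prop) measurableSet_Icc)]
  have hcont : Continuous fun x ↦ p * Real.sin (l * x) ^ 2 := by fun_prop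
  calc ENNReal.ofReal (p * ((d - c) / 2 - 1 / (2 * l)))
      ≤ ENNReal.ofReal (∫ x in c..d, p * Real.sin (l * x) ^ 2) := by
        rw [intervalIntegral.integral_const_mul]
        exact ENNReal.ofReal_le_ofReal (mul_le_mul_of_nonneg_left (le_integral_sin_sq hl) hp)
    _ = ∫⁻ x in Icc c d, ENNReal.ofReal (p * Real.sin (l * x) ^ 2) := by
        rw [intervalIntegral.integral_of_le hcd, ← integral_Icc_eq_integral_Ioc]
        exact ofReal_integral_eq_lintegral_ofReal
          (hcont.continuousOn.integrableOn_compact isCompact_Icc)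
          (.of_forall fun x ↦ mul_nonneg hp (sq_nonneg _))
    _ ≤ _ := by
        rw [← lintegral_indicator measurableSet_Icc]
        refine lintegral_mono fun x ↦ ?_
        by_cases hx : x ∈ Icc c d
        · rw [indicator_of_mem hx, Pi.mul_apply, indicator_of_mem hx, gaussianPDF,
            ← ENNReal.ofReal_mul (gaussianPDFReal_nonneg _ _ _)]
          exact ENNReal.ofReal_le_ofReal (mul_le_mul_of_nonneg_right (hpdf x hx) (sq_nonneg _))
        · rw [indicator_of_notMem hx]
          exact zero_le

/-- A lower bound for the density of `N(0, u)` on `[2k, 2k + 1]` for `u ∈ [α / 2, α]`. -/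
def densityBound (α : ℝ) (k : ℕ) : ℝ :=
  (√(2 * Real.pi * α))⁻¹ * Real.exp (-(2 * k + 1) ^ 2 / α)

theorem densityBound_pos {α : ℝ} (hα : 0 < α) (k : ℕ) : 0 < densityBound α k := by
  have := Real.pi_pos
  unfold densityBound
  positivity

theorem densityBound_le {α : ℝ} {u : ℝ≥0} (hα : 0 < α) (hu1 : α / 2 ≤ u) (hu2 : (u : ℝ) ≤ α)
    {k : ℕ} {x : ℝ} (hx : x ∈ Icc (2 * k : ℝ) (2 * k + 1)) :
    densityBound α k ≤ gaussianPDFReal 0 u x := by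
  have hpi := Real.pi_pos
  have hu : (0 : ℝ) < u := by linarith
  have hk : (0 : ℝ) ≤ k := by positivity
  unfold densityBound gaussianPDFReal
  refine mul_le_mul ?_ ?_ (Real.exp_nonneg _) (by positivity)
  · gcongr
  · rw [Real.exp_le_exp, sub_zero, neg_div, neg_div, neg_le_neg_iff]
    have hx2 : x ^ 2 ≤ (2 * k + 1) ^ 2 := pow_le_pow_left₀ (by linarith [hx.1]) hx.2 2
    exact div_le_div₀ (by positivity) hx2 hα (by linarith)

/-- Within one standard deviation the density is at least `exp (-1 / 2)` times its peak. -/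
theorem densityBound_small_le {v : ℝ≥0} (hv : v ≠ 0) {x : ℝ} (hx : x ∈ Icc 0 √(v : ℝ)) :
    (√(2 * Real.pi * v))⁻¹ * Real.exp (-1 / 2) ≤ gaussianPDFReal 0 v x := by
  have hv' : (0 : ℝ) < v := lt_of_le_of_ne v.2 fun h ↦ hv (NNReal.coe_eq_zero.1 h.symm)
  have hpi := Real.pi_pos
  unfold gaussianPDFReal
  refine mul_le_mul_of_nonneg_left ?_ (by positivity)
  rw [Real.exp_le_exp, sub_zero, neg_div, neg_div, neg_le_neg_iff,
    div_le_div_iff₀ (by positivity) (by norm_num)]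
  have := pow_le_pow_left₀ hx.1 hx.2 2
  rw [Real.sq_sqrt hv'.le] at this
  linarith

/-- The constant in the lower bound for the oscillations of the small Gaussian variable. -/
def oscillationConst (r : ℝ) : ℝ := (√(2 * Real.pi))⁻¹ * Real.exp (-1 / 2) * (r / 4)

theorem oscillationConst_pos {r : ℝ} (hr : 0 < r) : 0 < oscillationConst r := by
  have := Real.pi_pos
  unfold oscillationConst
  positivity

/-- If `U` lies in the middle half of the window and `0 ≤ V ≤ 1 / 4`, then `U + V` and `U - V` both
stay where `ψ` is linear, and the difference of cosines is a product of two sines. Bounding `|sin|`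
below by `sin²` and using independence leaves two one-dimensional integrals. -/
theorem lintegral_cos_sub_cos_ge {P : Measure Ω} [IsProbabilityMeasure P] {U V : Ω → ℝ}
    (hU : Measurable U) (hV : Measurable V) (hind : U ⟂ᵢ[P] V) {u v : ℝ≥0}
    (hUlaw : P.map U = gaussianReal 0 u) (hVlaw : P.map V = gaussianReal 0 v) {α r l : ℝ}
    (hα : 0 < α) (hu1 : α / 2 ≤ u) (hu2 : (u : ℝ) ≤ α) (hv : v ≠ 0) (hr0 : 0 < r) (hr1 : r ≤ 1)
    (hrv : r * √(v : ℝ) ≤ 1 / 4) (hl4 : 4 ≤ l) (hlv : 2 ≤ l * (r * √(v : ℝ))) {ψ : ℝ → ℝ} {k : ℕ}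
    (hψ : ∀ x ∈ Icc (2 * k : ℝ) (2 * k + 1), ψ x = l * x) :
    ENNReal.ofReal (2 * (densityBound α k / 8 * oscillationConst r)) ≤
      ∫⁻ ω, ‖Real.cos (ψ (U ω + V ω)) - Real.cos (ψ (U ω - V ω))‖ₑ ∂P := by
  have hl : 0 < l := by linarith
  have hv' : (0 : ℝ) < v := lt_of_le_of_ne v.2 fun h ↦ hv (NNReal.coe_eq_zero.1 h.symm)
  have hsv : 0 < √(v : ℝ) := Real.sqrt_pos.2 hv'
  have hu0 : u ≠ 0 := fun h ↦ by
    rw [h, NNReal.coe_zero] at hu1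
    linarith
  set A : ℝ → ℝ≥0∞ := (Icc (2 * k + 1 / 4 : ℝ) (2 * k + 3 / 4)).indicator
    fun x ↦ ENNReal.ofReal (Real.sin (l * x) ^ 2) with hA
  set B : ℝ → ℝ≥0∞ := (Icc 0 (r * √(v : ℝ))).indicator
    fun x ↦ ENNReal.ofReal (Real.sin (l * x) ^ 2) with hB
  have hAm : Measurable A := Measurable.indicator (by fun_prop) measurableSet_Icc
  have hBm : Measurable B := Measurable.indicator (by fun_prop) measurableSet_Icc
  have hpt : ∀ x y, 2 * (A x * B y) ≤ ‖Real.cos (ψ (x + y)) - Real.cos (ψ (x - y))‖ₑ := fun x y ↦ by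
    by_cases hx : x ∈ Icc (2 * k + 1 / 4 : ℝ) (2 * k + 3 / 4)
    swap
    · rw [hA, indicator_of_notMem hx, zero_mul, mul_zero]
      exact zero_le
    by_cases hy : y ∈ Icc 0 (r * √(v : ℝ))
    swap
    · rw [hB, indicator_of_notMem hy, mul_zero, mul_zero]
      exact zero_le
    have hy2 := hy.2.trans hrv
    have hadd : x + y ∈ Icc (2 * k : ℝ) (2 * k + 1) :=
      ⟨by linarith [hx.1, hy.1], by linarith [hx.2]⟩
    have hsub : x - y ∈ Icc (2 * k : ℝ) (2 * k + 1) :=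
      ⟨by linarith [hx.1], by linarith [hx.2, hy.1]⟩
    rw [hA, hB, indicator_of_mem hx, indicator_of_mem hy, hψ _ hadd, hψ _ hsub, Real.cos_sub_cos, Real.enorm_eq_ofReal_abs,
      ← ENNReal.ofReal_mul (sq_nonneg _), ← ENNReal.ofReal_ofNat 2,
      ← ENNReal.ofReal_mul (by norm_num)]
    refine ENNReal.ofReal_le_ofReal ?_
    have e1 : (l * (x + y) + l * (x - y)) / 2 = l * x := by ring
    have e2 : (l * (x + y) - l * (x - y)) / 2 = l * y := by ring
    rw [e1, e2, abs_mul, abs_mul, ← sq_abs (Real.sin (l * x)), ← sq_abs (Real.sin (l * y))]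
    have h1 := Real.abs_sin_le_one (l * x)
    have h2 := Real.abs_sin_le_one (l * y)
    have h3 : |Real.sin (l * x)| ^ 2 ≤ |Real.sin (l * x)| :=
      pow_le_of_le_one (abs_nonneg _) h1 (by norm_num)
    have h4 : |Real.sin (l * y)| ^ 2 ≤ |Real.sin (l * y)| :=
      pow_le_of_le_one (abs_nonneg _) h2 (by norm_num)
    have h5 := mul_le_mul h3 h4 (sq_nonneg _) (abs_nonneg _)
    have h6 : |(-2 : ℝ)| = 2 := by norm_num
    rw [h6]
    linarith
  have hUA : ENNReal.ofReal (densityBound α k / 8) ≤ ∫⁻ ω, A (U ω) ∂P := by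
    rw [← lintegral_map hAm hU, hUlaw]
    have hk : (0 : ℝ) ≤ k := by positivity
    have h := ofReal_le_lintegral_gaussianReal hu0 (c := 2 * k + 1 / 4) (d := 2 * k + 3 / 4) hl
      (by linarith) (densityBound_pos hα k).le fun x hx ↦ densityBound_le hα hu1 hu2
        ⟨by linarith [hx.1], by linarith [hx.2]⟩
    refine le_trans (ENNReal.ofReal_le_ofReal ?_) h
    -- The middle half has length `1 / 2`, so `l ≥ 4` leaves `1 / 4 - 1 / 8 = 1 / 8`.
    have hl8 : 1 / (2 * l) ≤ 1 / 8 := one_div_le_one_div_of_le (by norm_num) (by linarith)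
    rw [div_eq_mul_inv]
    refine mul_le_mul_of_nonneg_left ?_ (densityBound_pos hα k).le
    linarith
  have hVB : ENNReal.ofReal (oscillationConst r) ≤ ∫⁻ ω, B (V ω) ∂P := by
    rw [← lintegral_map hBm hV, hVlaw]
    have hpi := Real.pi_pos
    have h := ofReal_le_lintegral_gaussianReal hv (c := 0) (d := r * √(v : ℝ)) hl
      (by positivity) (p := (√(2 * Real.pi * v))⁻¹ * Real.exp (-1 / 2)) (by positivity)
      fun x hx ↦ densityBound_small_le hv ⟨hx.1, hx.2.trans (mul_le_of_le_one_left hsv.le hr1)⟩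
    refine le_trans (ENNReal.ofReal_le_ofReal ?_) h
    have hlow : r * √(v : ℝ) / 4 ≤ (r * √(v : ℝ) - 0) / 2 - 1 / (2 * l) := by
      have : 1 / (2 * l) ≤ r * √(v : ℝ) / 4 := by
        rw [div_le_div_iff₀ (by positivity) (by norm_num)]
        linarith
      linarith
    -- The interval length `r * √v` cancels the factor `1 / √v` of the density, which makes the
    -- bound independent of `v`.
    refine le_trans (le_of_eq ?_) (mul_le_mul_of_nonneg_left hlow (by positivity))
    rw [oscillationConst, Real.sqrt_mul (show 0 ≤ 2 * Real.pi by positivity) (v : ℝ), mul_inv]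
    have := hsv.ne'
    generalize √(v : ℝ) = q at this ⊢
    generalize √(2 * Real.pi) = q'
    field_simp
  calc ENNReal.ofReal (2 * (densityBound α k / 8 * oscillationConst r))
      = 2 * (ENNReal.ofReal (densityBound α k / 8) * ENNReal.ofReal (oscillationConst r)) := by
        rw [ENNReal.ofReal_mul (by norm_num),
          ENNReal.ofReal_mul (div_nonneg (densityBound_pos hα k).le (by norm_num)),
          ENNReal.ofReal_ofNat]
    _ ≤ 2 * ((∫⁻ ω, A (U ω) ∂P) * ∫⁻ ω, B (V ω) ∂P) := by gcongr
    _ = ∫⁻ ω, 2 * (A (U ω) * B (V ω)) ∂P := by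
        rw [lintegral_const_mul' _ _ (by simp)]
        congr 1
        exact (lintegral_mul_eq_lintegral_mul_lintegral_of_indepFun (hAm.comp hU) (hBm.comp hV)
          (hind.comp hAm hBm)).symm
    _ ≤ _ := lintegral_mono fun ω ↦ hpt _ _

end Oscillation

/-! ### Structure of the solutions of the stochastic equation. -/

section Solution

variable {Ω : Type*} {m : MeasurableSpace Ω} {T : ℝ}
  {𝓕 : Filtration (Icc (0 : ℝ) T) m} {P : Measure Ω} {W : Icc (0 : ℝ) T → Ω → ℝ}

theorem ae_forall_eq_of_continuous {X Y : Icc (0 : ℝ) T → Ω → ℝ}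
    (hX : ∀ ω, Continuous fun t ↦ X t ω) (hY : ∀ ω, Continuous fun t ↦ Y t ω)
    (h : ∀ t, ∀ᵐ ω ∂P, X t ω = Y t ω) : ∀ᵐ ω ∂P, ∀ t, X t ω = Y t ω := by
  obtain ⟨D, hDc, hDd⟩ := TopologicalSpace.exists_countable_dense (Icc (0 : ℝ) T)
  have h' : ∀ᵐ ω ∂P, ∀ t ∈ D, X t ω = Y t ω := (ae_ball_iff hDc).2 fun t _ ↦ h t
  filter_upwards [h'] with ω hω
  exact congrFun (Continuous.ext_on hDd (hX ω) (hY ω) hω)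

theorem continuous_wienerIntegral (hT : 0 ≤ T) (hW : ∀ ω, Continuous fun t ↦ W t ω)
    {φ : ℝ → ℝ} (hφ : ContDiff ℝ 1 φ) (c : ℝ) (ω : Ω) :
    Continuous fun d ↦ wienerIntegral hT W φ c d ω := by
  have hw : Continuous fun s ↦ W (projIcc 0 T hT s) ω := (hW ω).comp continuous_projIcc
  have hint := intervalIntegral.continuous_primitive (μ := volume)
    (fun x y ↦ ((hφ.continuous_deriv le_rfl).mul hw).intervalIntegrable x y) c
  exact ((hφ.continuous.mul hw).sub continuous_const).sub hint

theorem wienerIntegral_eq_of_zero (hT : 0 ≤ T) {φ : ℝ → ℝ} {s : ℝ} (hφ0 : ∀ x, s ≤ x → φ x = 0)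
    (hW : ∀ ω, Continuous fun t ↦ W t ω) (hφ : ContDiff ℝ 1 φ) {t t' : ℝ} (ht : s ≤ t)
    (htt' : t ≤ t') (c : ℝ) (ω : Ω) :
    wienerIntegral hT W φ c t ω = wienerIntegral hT W φ c t' ω := by
  rw [← wienerIntegral_add_adjacent hT hW hφ c t t' ω]
  have hd : ∀ x ∈ Ioi t, deriv φ x = 0 := fun x hx ↦ by
    have : φ =ᶠ[𝓝 x] fun _ ↦ 0 := by
      filter_upwards [Ioi_mem_nhds hx] with z hz using hφ0 z (ht.trans (le_of_lt hz))
    rw [this.deriv_eq]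
    simp
  have hz : ∫ x in t..t', deriv φ x * W (projIcc 0 T hT x) ω = 0 := by
    rw [intervalIntegral.integral_of_le htt']
    refine setIntegral_eq_zero_of_forall_eq_zero fun x hx ↦ ?_
    rw [hd x hx.1, zero_mul]
  simp [wienerIntegral, hz, hφ0 t ht, hφ0 t' (ht.trans htt')]

variable {f g ψ : ℝ → ℝ} {τ₁ : ℝ} {X₁ X₂ : Icc (0 : ℝ) T → Ω → ℝ}

/-- The equation for the second component holds almost surely for all times simultaneously. -/
theorem IsSolution.ae_forall_eq₂ (hT : 0 ≤ T) (hX : IsSolution 𝓕 P W f g ψ X₁ X₂)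
    (hg : Continuous g) (hψ : Continuous ψ) :
    ∀ᵐ ω ∂P, ∀ t ∈ Icc 0 T, X₂ (projIcc 0 T hT t) ω = t + ∫ s in (0 : ℝ)..t,
      g (X₂ (projIcc 0 T hT s) ω) * (Real.cos (ψ (X₁ (projIcc 0 T hT s) ω)) + 1) := by
  have hc : ∀ ω, Continuous fun s ↦
      g (X₂ (projIcc 0 T hT s) ω) * (Real.cos (ψ (X₁ (projIcc 0 T hT s) ω)) + 1) := fun ω ↦ by
    have h1 := (hX.continuousAdapted₁.continuous_path ω).comp
      (continuous_projIcc (h := hT))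
    have h2 := (hX.continuousAdapted₂.continuous_path ω).comp
      (continuous_projIcc (h := hT))
    exact (hg.comp h2).mul ((Real.continuous_cos.comp (hψ.comp h1)).add continuous_const)
  have h := ae_forall_eq_of_continuous (P := P) hX.continuousAdapted₂.continuous_path
    (Y := fun t ω ↦ (t : ℝ) + ∫ s in (0 : ℝ)..t,
      g (X₂ (projIcc 0 T hT s) ω) * (Real.cos (ψ (X₁ (projIcc 0 T hT s) ω)) + 1))
    (fun ω ↦ continuous_subtype_val.add ((intervalIntegral.continuous_primitive
      (fun x y ↦ (hc ω).intervalIntegrable x y) 0).comp continuous_subtype_val))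
    fun t ↦ by
      filter_upwards [hX.eq₂ t] with ω hω
      rw [hω, setIntegral_timeMeasure hT]
  filter_upwards [h] with ω hω t ht
  rw [projIcc_of_mem hT ht]
  exact hω ⟨t, ht⟩

/-- The first component is the Wiener integral of `f`, and the terminal value of the second
component solves the equation with constant speed given by the first component. -/
theorem IsSolution.ae_isTerminalValue [IsProbabilityMeasure P] (hT : 0 ≤ T)
    (hW : IsStandardBrownianMotion 𝓕 P W) (hX : IsSolution 𝓕 P W f g ψ X₁ X₂)
    (hτ₁ : τ₁ ∈ Icc 0 T) (hf : ContDiff ℝ 1 f) (hf0 : ∀ x, τ₁ ≤ x → f x = 0) {K : ℝ≥0}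
    (hgL : LipschitzWith K g) (hg0 : ∀ x ≤ τ₁, g x = 0) (hgnn : ∀ x, 0 ≤ g x)
    (hψ : Continuous ψ) :
    ∀ᵐ ω ∂P, IsTerminalValue g τ₁ T (Real.cos (ψ (wienerIntegral hT W f 0 T ω)) + 1)
      (X₂ ⟨T, right_mem_Icc.2 hT⟩ ω) := by
  have h2 := hX.ae_forall_eq₂ hT hgL.continuous hψ
  have hq2 : ∀ x, Real.cos x + 1 ∈ Icc (0 : ℝ) 2 := fun x ↦
    ⟨by linarith [Real.neg_one_le_cos x], by linarith [Real.cos_le_one x]⟩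
  have hcy : ∀ ω, Continuous fun s ↦ X₂ (projIcc 0 T hT s) ω := fun ω ↦
    (hX.continuousAdapted₂.continuous_path ω).comp continuous_projIcc
  have hcq : ∀ ω, Continuous fun s ↦ Real.cos (ψ (X₁ (projIcc 0 T hT s) ω)) + 1 := fun ω ↦
    (Real.continuous_cos.comp (hψ.comp ((hX.continuousAdapted₁.continuous_path ω).comp
      continuous_projIcc))).add continuous_const
  -- Before `τ₁` the second component is the identity; afterwards its nonnegative extra drift gives
  -- `X₂ s ≥ s ≥ τ₁`, and both values of `f` are zero. The integrand is therefore deterministic.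
  have hfX : ∀ᵐ ω ∂P, ∀ s : Icc (0 : ℝ) T, f (X₂ s ω) = f s := by
    filter_upwards [h2] with ω hω s
    rcases le_total (s : ℝ) τ₁ with hs | hs
    · have := eq_id_of_le hτ₁.2 hgL hg0 (hcy ω) (hcq ω) (fun t ↦ hq2 _) hω ⟨s.2.1, hs⟩
      rw [projIcc_val] at this
      rw [this]
    · have := hω s s.2
      rw [projIcc_val] at this
      have hnn := intervalIntegral.integral_nonneg (μ := volume) s.2.1 fun x _ ↦
        mul_nonneg (hgnn (X₂ (projIcc 0 T hT x) ω)) (hq2 (ψ (X₁ (projIcc 0 T hT x) ω))).1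
      rw [hf0 s hs, hf0 (X₂ s ω) (by linarith)]
  have h1 := ae_forall_eq_of_continuous (P := P) hX.continuousAdapted₁.continuous_path
    (Y := fun t ω ↦ wienerIntegral hT W f 0 t ω)
    (fun ω ↦ (continuous_wienerIntegral hT hW.continuous_path hf 0 ω).comp
      continuous_subtype_val)
    fun t ↦ (hX.eq₁ t).ae_eq_wienerIntegral hT hW hf (by
      filter_upwards [hfX] with ω hω s _ using hω s)
  filter_upwards [h1, h2] with ω hω1 hω2
  have hT' : X₂ (projIcc 0 T hT T) ω = X₂ ⟨T, right_mem_Icc.2 hT⟩ ω := by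
    rw [projIcc_of_mem hT (right_mem_Icc.2 hT)]
  rw [← hT']
  refine isTerminalValue_of_eq hτ₁.1 hτ₁.2 hgL hg0 (hcy ω) (hcq ω) (fun t ↦ hq2 _) hω2
    fun t ht ↦ ?_
  have ht0 : t ∈ Icc 0 T := ⟨hτ₁.1.trans ht.1, ht.2⟩
  rw [projIcc_of_mem hT ht0, hω1 ⟨t, ht0⟩]
  rw [wienerIntegral_eq_of_zero hT hf0 hW.continuous_path hf ht.1 ht.2 0 ω]

end Solution

/-! ### The lower bound for the approximation error. -/

section Error

/-- An abstract lower bound for the error of the approximation of `c F (cos (ψ (U + V)) + 1)` by a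
random variable which is independent of `V`. -/
theorem le_lintegral_approx {Ω : Type*} {𝓢 m : MeasurableSpace Ω} {P : Measure Ω}
    [IsProbabilityMeasure P] (h𝓢 : 𝓢 ≤ m) {U V Y : Ω → ℝ} (hU : Measurable[𝓢] U)
    (hV : Measurable V) (hY : Measurable[𝓢] Y)
    (hind : Indep (MeasurableSpace.comap V inferInstance) 𝓢 P) {u v : ℝ≥0}
    (hUlaw : P.map U = gaussianReal 0 u) (hVlaw : P.map V = gaussianReal 0 v) {α r l : ℝ}
    (hα : 0 < α) (hu1 : α / 2 ≤ u) (hu2 : (u : ℝ) ≤ α) (hv : v ≠ 0) (hr0 : 0 < r) (hr1 : r ≤ 1)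
    (hrv : r * √(v : ℝ) ≤ 1 / 4) (hl4 : 4 ≤ l) (hlv : 2 ≤ l * (r * √(v : ℝ))) {ψ : ℝ → ℝ}
    (hψ : Continuous ψ) {k : ℕ} (hψk : ∀ x ∈ Icc (2 * k : ℝ) (2 * k + 1), ψ x = l * x)
    {F : ℝ → ℝ} {κ : ℝ} (hκ : 0 ≤ κ) (hF : Monotone fun q ↦ F q - κ * q) {c : ℝ} (hc : 0 ≤ c) :
    ENNReal.ofReal (c * (κ * (densityBound α k / 8 * oscillationConst r))) ≤
      ∫⁻ ω, ‖c * F (Real.cos (ψ (U ω + V ω)) + 1) - Y ω‖ₑ ∂P := by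
  have hUm : Measurable U := hU.mono h𝓢 le_rfl
  have hUV : U ⟂ᵢ[P] V := by
    rw [IndepFun_iff_Indep]
    exact indep_of_indep_of_le_left hind.symm (measurable_iff_comap_le.1 hU)
  have hosc := lintegral_cos_sub_cos_ge hUm hV hUV hUlaw hVlaw hα hu1 hu2 hv hr0 hr1 hrv hl4 hlv
    hψk
  have hFm : Measurable F := by
    have : F = fun q ↦ (F q - κ * q) + κ * q := by
      ext q
      ring
    rw [this]
    exact hF.measurable.add (measurable_const_mul κ)
  have hFdist : ∀ q₁ q₂, κ * |q₁ - q₂| ≤ |F q₁ - F q₂| := fun q₁ q₂ ↦ by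
    rcases le_total q₁ q₂ with h | h
    · have := hF h
      simp only at this
      rw [abs_of_nonpos (by linarith), abs_sub_comm]
      refine le_trans ?_ (le_abs_self _)
      linarith
    · have := hF h
      simp only at this
      rw [abs_of_nonneg (by linarith)]
      refine le_trans ?_ (le_abs_self _)
      linarith
  set G : ℝ → ℝ := fun x ↦ c * F (Real.cos (ψ x) + 1) with hGdef
  have hGm : Measurable G := (hFm.comp
    ((Real.continuous_cos.comp hψ).add continuous_const).measurable).const_mul c
  have hGdist : ∀ x y, ENNReal.ofReal (c * κ) * ‖Real.cos (ψ x) - Real.cos (ψ y)‖ₑ ≤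
      ‖G x - G y‖ₑ := fun x y ↦ by
    rw [Real.enorm_eq_ofReal_abs, Real.enorm_eq_ofReal_abs, ← ENNReal.ofReal_mul (by positivity)]
    refine ENNReal.ofReal_le_ofReal ?_
    have h := hFdist (Real.cos (ψ x) + 1) (Real.cos (ψ y) + 1)
    rw [add_sub_add_right_eq_sub] at h
    rw [hGdef, ← mul_sub, abs_mul, abs_of_nonneg hc, mul_assoc]
    exact mul_le_mul_of_nonneg_left h hc
  -- The factor `2` of the product formula for cosines cancels the `2` lost in the symmetrization.
  have hchain : 2 * ENNReal.ofReal (c * (κ * (densityBound α k / 8 * oscillationConst r))) ≤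
      2 * ∫⁻ ω, ‖G (U ω + V ω) - Y ω‖ₑ ∂P := by
    refine le_trans ?_ (lintegral_symmetrization_le h𝓢 hV hind hU hY hVlaw hGm)
    refine le_trans ?_ (lintegral_mono fun ω ↦ hGdist (U ω + V ω) (U ω - V ω))
    rw [lintegral_const_mul' _ _ (by simp)]
    refine le_trans (le_of_eq ?_) (mul_le_mul_right hosc (ENNReal.ofReal (c * κ)))
    rw [← ENNReal.ofReal_mul (by positivity), ← ENNReal.ofReal_ofNat 2,
      ← ENNReal.ofReal_mul (by norm_num)]
    congr 1
    ring
  exact (ENNReal.mul_le_mul_iff_right (by simp) (by simp)).1 hchain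

variable {Ω : Type*} {m : MeasurableSpace Ω} {T : ℝ}
  {𝓕 : Filtration (Icc (0 : ℝ) T) m} {P : Measure Ω} {W : Icc (0 : ℝ) T → Ω → ℝ}

/-- The Wiener integral of `f` splits into a part which is determined by `W` outside of `(a, b)` and
an independent centred Gaussian part. -/
theorem IsStandardBrownianMotion.exists_decomposition [IsProbabilityMeasure P] (hT : 0 ≤ T)
    (hW : IsStandardBrownianMotion 𝓕 P W) {f : ℝ → ℝ} (hf : ContDiff ℝ 1 f) {a b : ℝ}
    (ha : 0 ≤ a) (hab : a < b) (hb : b ≤ T) (hS : Icc 0 a ∪ Icc b T ⊆ Icc 0 T) :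
    ∃ U V : Ω → ℝ, Measurable[pathSigma W (Icc 0 a ∪ Icc b T) hS] U ∧ Measurable V ∧
      Indep (MeasurableSpace.comap V inferInstance) (pathSigma W (Icc 0 a ∪ Icc b T) hS) P ∧
      P.map V = gaussianReal 0 (Real.toNNReal (∫ s in a..b, (f s - mean f a b) ^ 2)) ∧
      ∀ ω, wienerIntegral hT W f 0 T ω = U ω + V ω := by
  have haT : a ∈ Icc 0 T := ⟨ha, hab.le.trans hb⟩
  have hbT : b ∈ Icc 0 T := ⟨ha.trans hab.le, hb⟩
  have hpath := hW.continuous_path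
  have hφ : ContDiff ℝ 1 fun s ↦ f s - mean f a b := hf.sub contDiff_const
  have hmem : ∀ s ∈ Icc 0 a ∪ Icc b T,
      Measurable[pathSigma W (Icc 0 a ∪ Icc b T) hS] (W (projIcc 0 T hT s)) := fun s hs ↦ by
    rw [projIcc_of_mem hT (hS hs)]
    exact measurable_pathSigma hS hs
  -- On `[a, b]` the mean of `f` contributes a multiple of `W_b - W_a`, which is visible from
  -- outside; the remainder `f - mean` has mean zero and gives the hidden part.
  refine ⟨fun ω ↦ wienerIntegral hT W f 0 a ω +
    mean f a b * (W (projIcc 0 T hT b) ω - W (projIcc 0 T hT a) ω) +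
    wienerIntegral hT W f b T ω, wienerIntegral hT W (fun s ↦ f s - mean f a b) a b,
    ?_, ?_, ?_, ?_, fun ω ↦ ?_⟩
  · exact ((measurable_wienerIntegral hT hpath _ hf ha fun s hs ↦ hmem s (Or.inl hs)).add
      (((hmem b (Or.inr (left_mem_Icc.2 hb))).sub
        (hmem a (Or.inl (right_mem_Icc.2 ha)))).const_mul _)).add
      (measurable_wienerIntegral hT hpath _ hf hb fun s hs ↦ hmem s (Or.inr hs))
  · exact measurable_wienerIntegral hT hpath m hφ hab.le fun s _ ↦ hW.measurable _
  · exact hW.indep_wienerIntegral hT (a := ⟨a, haT⟩) (b := ⟨b, hbT⟩) hab hS hφ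
      (integral_sub_mean hf.continuous hab)
  · exact (hW.hasLaw_wienerIntegral hT hφ ha hab.le hb).map_eq
  · rw [wienerIntegral_sub_const, ← wienerIntegral_add_adjacent hT hpath hf 0 b T,
      ← wienerIntegral_add_adjacent hT hpath hf 0 a b]
    ring

/-- The condition `v ≤ α / 2` keeps the variance `α - v` of the visible part in `[α / 2, α]`, so its
density on a window is bounded below uniformly in the gap. -/
theorem IsStandardBrownianMotion.approxError_ge [IsProbabilityMeasure P] (hT : 0 ≤ T)
    (hW : IsStandardBrownianMotion 𝓕 P W) {f : ℝ → ℝ} (hf : ContDiff ℝ 1 f) {α : ℝ}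
    (hα : 0 < α) (hfα : ∫ s in (0 : ℝ)..T, f s ^ 2 = α) {a b : ℝ} (ha : 0 ≤ a) (hab : a < b)
    (hb : b ≤ T) (hS : Icc 0 a ∪ Icc b T ⊆ Icc 0 T) {v : ℝ}
    (hv : ∫ s in a..b, (f s - mean f a b) ^ 2 = v) (hv0 : 0 < v) (hvα : v ≤ α / 2)
    {F : ℝ → ℝ} {κ : ℝ} (hκ : 0 ≤ κ) (hF : Monotone fun q ↦ F q - κ * q) {ψ : ℝ → ℝ}
    (hψ : Continuous ψ) {c : ℝ} (hc : 0 ≤ c) {r l : ℝ} (hr0 : 0 < r) (hr1 : r ≤ 1)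
    (hrv : r * √v ≤ 1 / 4) (hl4 : 4 ≤ l) (hlv : 2 ≤ l * (r * √v)) {k : ℕ}
    (hψk : ∀ x ∈ Icc (2 * k : ℝ) (2 * k + 1), ψ x = l * x) {Z : Ω → ℝ}
    (hZ : ∀ᵐ ω ∂P, Z ω = c * F (Real.cos (ψ (wienerIntegral hT W f 0 T ω)) + 1)) :
    ENNReal.ofReal (c * (κ * (densityBound α k / 8 * oscillationConst r))) ≤
      approxError P W hW.continuous_path (Icc 0 a ∪ Icc b T) hS Z := by
  obtain ⟨U, V, hU, hV, hind, hVlaw, hUV⟩ := hW.exists_decomposition hT hf ha hab hb hS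
  have h𝓢 := pathSigma_le hW.measurable hS
  rw [hv] at hVlaw
  have hUVind : U ⟂ᵢ[P] V := by
    rw [IndepFun_iff_Indep]
    exact indep_of_indep_of_le_left hind.symm (measurable_iff_comap_le.1 hU)
  have hLlaw : P.map (U + V) = gaussianReal 0 (Real.toNNReal α) := by
    have := (hW.hasLaw_wienerIntegral hT hf le_rfl hT le_rfl).map_eq
    rw [hfα] at this
    rw [← this]
    congr 1
    exact (funext hUV).symm
  have hUlaw := hasLaw_gaussianReal_of_add (hU.mono h𝓢 le_rfl) hV hUVind
    (Real.toNNReal_le_toNNReal (by linarith : v ≤ α)) hVlaw hLlaw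
  have hcoe : ((Real.toNNReal α - Real.toNNReal v : ℝ≥0) : ℝ) = α - v := by
    rw [NNReal.coe_sub (Real.toNNReal_le_toNNReal (by linarith)), Real.coe_toNNReal _ hα.le,
      Real.coe_toNNReal _ hv0.le]
  have hvcoe : (Real.toNNReal v : ℝ) = v := Real.coe_toNNReal _ hv0.le
  refine le_iInf₂ fun u hu ↦ ?_
  have hY : Measurable[pathSigma W (Icc 0 a ∪ Icc b T) hS]
      fun ω ↦ u (pathOn W hW.continuous_path (Icc 0 a ∪ Icc b T) hS ω) :=
    @Measurable.comp _ _ _ (pathSigma W (Icc 0 a ∪ Icc b T) hS) (borel _) _ _ _ hu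
      (measurable_pathOn hW.continuous_path hS (isCompact_Icc.union isCompact_Icc))
  refine (le_lintegral_approx h𝓢 hU hV hY hind hUlaw hVlaw hα (by rw [hcoe]; linarith)
    (by rw [hcoe]; linarith) (Real.toNNReal_pos.2 hv0).ne' hr0 hr1 (by rwa [hvcoe]) hl4
    (by rwa [hvcoe]) hψ hψk hκ hF hc).trans (le_of_eq (lintegral_congr_ae ?_))
  filter_upwards [hZ] with ω hω
  rw [hω, hUV]

end Error

/-! ### Choice of slopes and proof of the main theorem. -/

/-- The slopes and the thresholds which make the error bounds dominate a given sequence. -/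
theorem exists_slopes {D : ℕ → ℝ} (hD : ∀ k, 0 < D k) {δ : ℕ → ℝ}
    (hδ : limsup (fun n ↦ (δ n : EReal)) atTop ≤ 0) {s : ℕ → ℝ} (hs : ∀ n, 0 < s n) :
    ∃ l : ℕ → ℝ, (∀ k, 4 ≤ l k) ∧ ∃ c : ℝ, 0 < c ∧ ∀ n, ∃ k, 2 ≤ l k * s n ∧ δ n ≤ c * D k := by
  classical
  have hev : ∀ x : ℝ, 0 < x → ∃ N, ∀ n, N ≤ n → δ n ≤ x := fun x hx ↦ by
    have h := eventually_lt_of_limsup_lt (lt_of_le_of_lt hδ (EReal.coe_pos.2 hx))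
    obtain ⟨N, hN⟩ := eventually_atTop.1 h
    exact ⟨N, fun n hn ↦ (EReal.coe_lt_coe_iff.1 (hN n hn)).le⟩
  -- From index `N₀ k` on, `δ` is below the bound of the next window `k + 1`. The term `k + 1` in `N
  -- k` puts every index below some threshold.
  choose N₀ hN₀ using fun k ↦ hev (D (k + 1)) (hD _)
  obtain ⟨N₁, hN₁⟩ := hev 1 one_pos
  set N : ℕ → ℕ := fun k ↦ max (N₀ k) (k + 1)
  set M : ℝ := 1 + ∑ n ∈ Finset.range N₁, |δ n| with hM
  have hδM : ∀ n, δ n ≤ M := fun n ↦ by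
    rcases le_or_gt N₁ n with hn | hn
    · have := Finset.sum_nonneg (s := Finset.range N₁) fun n _ ↦ abs_nonneg (δ n)
      linarith [hN₁ n hn]
    · have := Finset.single_le_sum (f := fun n ↦ |δ n|) (fun n _ ↦ abs_nonneg (δ n))
        (Finset.mem_range.2 hn)
      linarith [le_abs_self (δ n)]
  -- The sum dominates `2 / s n` for every `n < N k`. Index `n` uses the first `k` with `n < N k`:
  -- if `k = j + 1`, then `n ≥ N j` gives `δ n ≤ D k`; if `k = 0`, the bound `M` and the size of `c`
  -- suffice.
  refine ⟨fun k ↦ 4 + ∑ n ∈ Finset.range (N k), 2 / s n, fun k ↦ ?_, max 1 (M / D 0),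
    lt_max_of_lt_left one_pos, fun n ↦ ?_⟩
  · have := Finset.sum_nonneg (s := Finset.range (N k)) fun n _ ↦ (div_pos two_pos (hs n)).le
    linarith
  have hex : ∃ k, n < N k := ⟨n, (Nat.lt_succ_self n).trans_le (le_max_right _ _)⟩
  refine ⟨Nat.find hex, ?_, ?_⟩
  · have h1 := Finset.single_le_sum (f := fun n ↦ 2 / s n)
      (fun n _ ↦ (div_pos two_pos (hs n)).le) (Finset.mem_range.2 (Nat.find_spec hex))
    rw [← div_le_iff₀ (hs n)]
    linarith
  · rcases Nat.eq_zero_or_eq_succ_pred (Nat.find hex) with h | h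
    · rw [h, ← div_le_iff₀ (hD 0)]
      exact (div_le_div_of_nonneg_right (hδM n) (hD 0).le).trans (le_max_right _ _)
    · set j := (Nat.find hex).pred
      have hj : N j ≤ n := not_lt.1 (Nat.find_min hex (by omega))
      rw [h]
      refine (hN₀ j n ((le_max_left _ _).trans hj)).trans ?_
      exact le_mul_of_one_le_left (hD _).le (le_max_left _ _)

end SlowSDE

end

theorem corollary3p19
    {T τ τ₁ τ₂ : ℝ} (hT : 0 < T) (hτ : τ ∈ Ioo 0 T) (hτ₁ : τ₁ ∈ Ioo τ T) (hτ₂ : τ₂ ∈ Ioo τ₁ T)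
    {f g : ℝ → ℝ} (hf : ContDiff ℝ (⊤ : ℕ∞) f) (hg : ContDiff ℝ (⊤ : ℕ∞) g)
    (hfg_bdd : ∃ C : ℝ, ∀ x, |f x| + |g x| ≤ C)
    (hf_pos : f '' Iio τ₁ ⊆ Ioi 0) (hf_zero : f '' Ici τ₁ = {0})
    (hf_deriv : range (deriv f) ⊆ Icc (-2) 0)
    (hf_deriv' : deriv f '' Ioo 0 τ ⊆ Ico (-2) (-1))
    (hg_zero : g '' Iic τ₁ = {0}) (hg_four : g '' Ici τ₂ = {4})
    (hg_deriv : range (deriv g) ⊆ Ici 0)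
    {α : ℝ} (hα_le : 2 * τ ^ 3 / 3 ≤ α) (hα : α = ∫ s in (0 : ℝ)..τ₁, |f s| ^ 2)
    {Ω : Type*} {m : MeasurableSpace Ω} (P : Measure Ω) [IsProbabilityMeasure P]
    (𝓕 : Filtration (Icc (0 : ℝ) T) m) (h𝓕 : SlowSDE.IsNormalFiltration 𝓕 P)
    (W : Icc (0 : ℝ) T → Ω → ℝ) (hW : SlowSDE.IsStandardBrownianMotion 𝓕 P W)
    (X₁ X₂ : (ℝ → ℝ) → Icc (0 : ℝ) T → Ω → ℝ)
    (hX : ∀ ψ : ℝ → ℝ, ContDiff ℝ (⊤ : ℕ∞) ψ → SlowSDE.IsSolution 𝓕 P W f g ψ (X₁ ψ) (X₂ ψ))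
    (ε δ : ℕ → ℝ) (hε : ∀ n, ε n ∈ Ioc 0 τ)
    (hδ : limsup (fun n ↦ (δ n : EReal)) atTop ≤ 0) :
    ∃ ψ : ℝ → ℝ, ContDiff ℝ (⊤ : ℕ∞) ψ ∧
    ∃ c : ℝ, 0 < c ∧
    ∃ Φ : C(Icc (0 : ℝ) T, ℝ) → ℝ, Measurable[borel C(Icc (0 : ℝ) T, ℝ)] Φ ∧
    ∃ Z : Icc (0 : ℝ) T → Ω → ℝ, SlowSDE.IsContinuousAdapted 𝓕 Z ∧
      (∀ᵐ ω ∂P, Z ⟨T, right_mem_Icc.2 hT.le⟩ ω =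
        Φ (SlowSDE.pathOn W hW.continuous_path (Icc 0 T) subset_rfl ω)) ∧
      (∀ t, SlowSDE.HasItoIntegral 𝓕 P W (fun s ω ↦ f (Z s ω / c)) t (X₁ ψ t)) ∧
      (∀ t, ∀ᵐ ω ∂P, Z t ω =
        ∫ s in Iic t, (c + c * g (Z s ω / c) * (Real.cos (ψ (X₁ ψ s ω)) + 1))
          ∂SlowSDE.timeMeasure T) ∧
      ∀ n, ENNReal.ofReal (δ n) ≤
        ⨅ (a : ℝ) (b : ℝ) (ha : a ∈ Icc 0 τ) (hb : b ∈ Icc 0 τ) (_ : ε n ≤ b - a),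
          SlowSDE.approxError P W hW.continuous_path (Icc 0 a ∪ Icc b T)
            (SlowSDE.outsideGap_subset hτ.2 ha hb) (Z ⟨T, right_mem_Icc.2 hT.le⟩) := by
  have hT0 : 0 ≤ T := hT.le
  have hf1 : ContDiff ℝ 1 f := hf.of_le (by exact_mod_cast le_top)
  have hg1 : ContDiff ℝ 1 g := hg.of_le (by exact_mod_cast le_top)
  have hτ₁T : τ₁ < T := hτ₂.1.trans hτ₂.2
  have hτ₁0 : 0 < τ₁ := hτ.1.trans hτ₁.1
  have hf0 : ∀ x, τ₁ ≤ x → f x = 0 := fun x hx ↦ by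
    have : f x ∈ f '' Ici τ₁ := mem_image_of_mem f hx
    rwa [hf_zero] at this
  have hg0 : ∀ x ≤ τ₁, g x = 0 := fun x hx ↦ by
    have : g x ∈ g '' Iic τ₁ := mem_image_of_mem g hx
    rwa [hg_zero] at this
  have hg4 : ∀ x, τ₂ ≤ x → g x = 4 := fun x hx ↦ by
    have : g x ∈ g '' Ici τ₂ := mem_image_of_mem g hx
    rwa [hg_four] at this
  have hgmono : Monotone g :=
    monotone_of_deriv_nonneg (hg1.differentiable (by simp)) fun x ↦ hg_deriv ⟨x, rfl⟩
  have hgb : ∀ x, g x ∈ Icc 0 4 := fun x ↦ by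
    constructor
    · rw [← hg0 (min x τ₁) (min_le_right _ _)]
      exact hgmono (min_le_left _ _)
    · rw [← hg4 (max x τ₂) (le_max_right _ _)]
      exact hgmono (le_max_left _ _)
  obtain ⟨K, hgL⟩ := SlowSDE.exists_lipschitzWith_of_const_outside hg1 hg_zero hg_four
  obtain ⟨F, hF, hFeq⟩ :=
    SlowSDE.exists_terminal_function hτ₂.1.le hτ₂.2.le hg1.continuous hgb hg4
  set κ := 4 / 81 * (T - τ₂)
  have hκ : 0 < κ := mul_pos (by norm_num) (sub_pos.2 hτ₂.2)
  have hαpos : 0 < α := lt_of_lt_of_le (by have := hτ.1; positivity) hα_le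
  have hfα : ∫ s in (0 : ℝ)..T, f s ^ 2 = α := by
    have hc : Continuous fun s ↦ f s ^ 2 := hf1.continuous.pow 2
    rw [hα, ← intervalIntegral.integral_add_adjacent_intervals (hc.intervalIntegrable 0 τ₁)
      (hc.intervalIntegrable τ₁ T), intervalIntegral.integral_zero_ae (a := τ₁)]
    · simp
    · refine .of_forall fun s hs ↦ ?_
      rw [uIoc_of_le hτ₁T.le] at hs
      simp [hf0 s hs.1.le]
  -- One `r` serves all gaps: `r * √v ≤ 1 / 4` whenever `v ≤ α`.
  set r := min 1 (1 / (4 * √α)) with hr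
  have hsα : 0 < √α := Real.sqrt_pos.2 hαpos
  have hr0 : 0 < r := lt_min one_pos (by positivity)
  have hrα : r * √α ≤ 1 / 4 := by
    refine (mul_le_mul_of_nonneg_right (min_le_right _ _) hsα.le).trans (le_of_eq ?_)
    field_simp
  -- `D k` is the error bound of window `k` without the factor `c`, and `s n` is the least value of
  -- `r * √v` over gaps of length at least `ε n` that the variance bound guarantees.
  obtain ⟨l, hl4, c, hc, hlc⟩ := SlowSDE.exists_slopes
    (D := fun k ↦ κ * (SlowSDE.densityBound α k / 8 * SlowSDE.oscillationConst r))
    (fun k ↦ mul_pos hκ (mul_pos (div_pos (SlowSDE.densityBound_pos hαpos k) (by norm_num))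
      (SlowSDE.oscillationConst_pos hr0))) hδ
    (s := fun n ↦ r * √(ε n ^ 3 / 12))
    fun n ↦ mul_pos hr0 (Real.sqrt_pos.2 (by have := (hε n).1; positivity))
  obtain ⟨ψ, hψ, hψl⟩ := SlowSDE.exists_contDiff_piecewise_linear l
  have hsol := hX ψ hψ
  have hZT : ∀ᵐ ω ∂P, c * X₂ ψ ⟨T, right_mem_Icc.2 hT0⟩ ω =
      c * F (Real.cos (ψ (SlowSDE.wienerIntegral hT0 W f 0 T ω)) + 1) := by
    filter_upwards [hsol.ae_isTerminalValue hT0 hW ⟨hτ₁0.le, hτ₁T.le⟩ hf1 hf0 hgL hg0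
      (fun x ↦ (hgb x).1) hψ.continuous] with ω hω
    rw [hFeq _ _ hω]
  -- `Z` is `c X₂`, and `Φ` evaluates the pathwise Wiener integral on the coordinate process of path
  -- space.
  refine ⟨ψ, hψ, c, hc,
    fun p ↦ c * F (Real.cos (ψ (SlowSDE.wienerIntegral hT0 (fun t p ↦ p t) f 0 T p)) + 1), ?_,
    fun t ω ↦ c * X₂ ψ t ω, ?_, hZT, fun t ↦ ?_, fun t ↦ ?_, fun n ↦ ?_⟩
  · let _ : MeasurableSpace C(Icc (0 : ℝ) T, ℝ) := borel _
    have : BorelSpace C(Icc (0 : ℝ) T, ℝ) := ⟨rfl⟩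
    have hFm : Measurable F := by
      have : F = fun q ↦ (F q - κ * q) + κ * q := by
        ext q
        ring
      rw [this]
      exact hF.measurable.add (measurable_const_mul κ)
    have hL : Measurable (SlowSDE.wienerIntegral hT0
        (fun t (p : C(Icc (0 : ℝ) T, ℝ)) ↦ p t) f 0 T) :=
      SlowSDE.measurable_wienerIntegral hT0 (fun p ↦ p.continuous) _ hf1 hT0 fun s _ ↦
        (continuous_eval_const (F := C(Icc (0 : ℝ) T, ℝ)) _).measurable
    exact (hFm.comp (((Real.continuous_cos.comp hψ.continuous).add
      continuous_const).measurable.comp hL)).const_mul c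
  · exact ⟨fun t ↦ (hsol.continuousAdapted₂.adapted t).const_mul c,
      fun ω ↦ continuous_const.mul (hsol.continuousAdapted₂.continuous_path ω)⟩
  · simp only [mul_div_cancel_left₀ _ hc.ne']
    exact hsol.eq₁ t
  · filter_upwards [hsol.eq₂ t] with ω hω
    simp only [mul_div_cancel_left₀ _ hc.ne']
    have hcont : Continuous fun s ↦
        g (X₂ ψ s ω) * (Real.cos (ψ (X₁ ψ s ω)) + 1) := by
      have h1 := hsol.continuousAdapted₁.continuous_path ω
      have h2 := hsol.continuousAdapted₂.continuous_path ω
      have h3 := hψ.continuous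
      have h4 := hg1.continuous
      fun_prop
    have hint : Integrable (fun s ↦ g (X₂ ψ s ω) * (Real.cos (ψ (X₁ ψ s ω)) + 1))
        ((SlowSDE.timeMeasure T).restrict (Iic t)) :=
      (hcont.integrable_of_hasCompactSupport (HasCompactSupport.of_compactSpace _)).restrict
    simp only [mul_assoc]
    rw [integral_add (integrable_const c) (hint.const_mul c), integral_const_mul, setIntegral_const,
      measureReal_def, SlowSDE.timeMeasure_Iic, ENNReal.toReal_ofReal t.2.1, hω, smul_eq_mul]
    ring
  · refine le_iInf fun a ↦ le_iInf fun b ↦ le_iInf fun ha ↦ le_iInf fun hb ↦ le_iInf fun hab ↦ ?_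
    obtain ⟨k, hlk, hδk⟩ := hlc n
    have hεn := (hε n).1
    have hab' : a < b := by linarith
    have hv := SlowSDE.variance_bounds hf1 hf_deriv' ha.1 hab' hb.2
    have hε3 : ε n ^ 3 / 12 ≤ (b - a) ^ 3 / 12 := by gcongr
    have hτ3 : (b - a) ^ 3 ≤ τ ^ 3 :=
      pow_le_pow_left₀ (by linarith) (by linarith [ha.1, hb.2]) 3
    -- The assumption `2 * τ ^ 3 / 3 ≤ α` enters here: `v ≤ (b - a) ^ 3 / 3 ≤ τ ^ 3 / 3 ≤ α / 2`.
    have hvα : ∫ s in a..b, (f s - SlowSDE.mean f a b) ^ 2 ≤ α / 2 := by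
      linarith [hv.2]
    have hv0 : 0 < ∫ s in a..b, (f s - SlowSDE.mean f a b) ^ 2 :=
      lt_of_lt_of_le (by positivity) (hε3.trans hv.1)
    refine (ENNReal.ofReal_le_ofReal hδk).trans ?_
    refine hW.approxError_ge hT0 hf1 hαpos hfα ha.1 hab' (hb.2.trans hτ.2.le) _ rfl hv0 hvα hκ.le
      hF hψ.continuous hc.le hr0 (min_le_left _ _) ?_ (hl4 k) ?_ (hψl k) hZT
    · refine le_trans (mul_le_mul_of_nonneg_left (Real.sqrt_le_sqrt ?_) hr0.le) hrα
      linarith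
    · refine hlk.trans (mul_le_mul_of_nonneg_left (mul_le_mul_of_nonneg_left
        (Real.sqrt_le_sqrt (hε3.trans hv.1)) hr0.le) (by linarith [hl4 k]))
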